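/- Lemma (Transdimensional balance). Fix $T>0$ and $\alpha>0$. Let $D$ be the set of non-decreasing right-continuous functions $X:[0,T]\to\mathbb R$ with $X_0=0$, with the $\sigma$-algebra generated by the coordinate maps $X\mapsto X_t$, and write $\Delta X_s=X_s-X_{s-}$ for $s>0$ and $\Delta X_0=0$. For $\beta>0$ let $\tilde{\mathbb P}_\beta$ be the law on $D$ of a $\mathrm{Gamma}(\beta,\alpha)$ process, i.e. the process with independent increments for which $X_t-X_s$ ($0\le s<t\le T$) has the gamma distribution with shape $\beta(t-s)$ and rate $\alpha$. For $\beta,\beta^\circ>0$ and $X\in D$ let $\mathbb Q_{\beta,\beta^\circ}(X;\cdot)$ be the law on $D$ of the following random path $X^\circ$: - if $\beta^\circ>\beta$: $X^\circ=X+X'$ with $X'\sim\tilde{\mathbb P}_{\beta^\circ-\beta}$; - if $\beta^\circ<\beta$: $X^\circ_t=\sum_{s\le t,\ \Delta X_s>0}U_s\,\Delta X_s$, with $U_s$ independent $\mathrm{Bernoulli}(\beta^\circ/\beta)$ random variables indexed by $\{s:\Delta X_s>0\}$; - if $\beta^\circ=\beta$: $X^\circ=X$. Then $\beta\mapsto\tilde{\mathbb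 P}_\beta$ and $(\beta,\beta^\circ,X)\mapsto\mathbb Q_{\beta,\beta^\circ}(X;\cdot)$ are (jointly measurable) probability kernels; for all $\beta,\beta^\circ>0$, $$\tilde{\mathbb P}_\beta(\mathrm dX)\,\mathbb Q_{\beta,\beta^\circ}(X;\mathrm dX^\circ)=\tilde{\mathbb P}_{\beta^\circ}(\mathrm dX^\circ)\,\mathbb Q_{\beta^\circ,\beta}(X^\circ;\mathrm dX)$$ as measures on $D\times D$; and $$\mu\big((\mathrm d\beta,\mathrm dX),(\mathrm d\beta^\circ,\mathrm dX^\circ)\big)=\mathrm d\beta\,\mathrm d\beta^\circ\,\tilde{\mathbb P}_\beta(\mathrm dX)\,\mathbb Q_{\beta,\beta^\circ}(X;\mathrm dX^\circ)$$ defines a measure on $\big((0,\infty)\times D\big)^2$ that is symmetric, i.e. invariant under exchanging $(\beta,X)$ and $(\beta^\circ,X^\circ)$. -/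

import Mathlib

open MeasureTheory ProbabilityTheory Set Filter Topology

/-- A path of a subordinator on the time interval `[0, T]`: a non-decreasing, right-continuous
function started at `0` (left limits exist by monotonicity). -/
structure SubPath (T : ℝ) where
  toFun : Icc (0 : ℝ) T → ℝ
  mono : Monotone toFun
  rightCts : ∀ t, ContinuousWithinAt toFun (Ici t) t
  start : ∀ t : Icc (0 : ℝ) T, (t : ℝ) = 0 → toFun t = 0

namespace SubPath

variable {T : ℝ}

instance : CoeFun (SubPath T) (fun _ => Icc (0 : ℝ) T → ℝ) := ⟨SubPath.toFun⟩

/-- The path space carries the `σ`-algebra generated by the coordinates `x ↦ x t`. -/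
instance : MeasurableSpace (SubPath T) := MeasurableSpace.comap SubPath.toFun inferInstance

/-- The pointwise sum of two paths. -/
instance : Add (SubPath T) :=
  ⟨fun x y =>
    { toFun := fun t => x t + y t
      mono := fun _ _ h => add_le_add (x.mono h) (y.mono h)
      rightCts := fun t => (x.rightCts t).add (y.rightCts t)
      start := fun t ht => by rw [x.start t ht, y.start t ht, add_zero] }⟩

/-- The jump `Δx_s = x_s - x_{s-}`. At the left end point `s = 0` it is `0`. -/
noncomputable def jump (x : SubPath T) (s : Icc (0 : ℝ) T) : ℝ :=
  x s - Function.leftLim x.toFun s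

/-- The (countable) set of jump times `{s : Δx_s > 0}`. -/
def jumpTimes (x : SubPath T) : Set (Icc (0 : ℝ) T) := {s | 0 < x.jump s}

lemma jump_nonneg (x : SubPath T) (s : Icc (0 : ℝ) T) : 0 ≤ x.jump s :=
  sub_nonneg.2 (x.mono.leftLim_le le_rfl)

/-- Finitely many jumps up to time `t` add up to at most `x t` (minus any lower bound of `x`). -/
lemma sum_jump_le (x : SubPath T) (z : ℝ) (hz : ∀ s, z ≤ x s) (F : Finset (Icc (0 : ℝ) T)) :
    ∀ t : Icc (0 : ℝ) T, (∀ s ∈ F, s ≤ t) → ∑ s ∈ F, x.jump s ≤ x t - z := by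
  induction F using Finset.induction_on_max with
  | empty => intro t _; simpa using hz t
  | insert a F ha ih =>
    intro t ht
    have hat : a ≤ t := ht a (by simp)
    rw [Finset.sum_insert (fun h => lt_irrefl _ (ha a h))]
    have hle : ∑ s ∈ F, x.jump s ≤ Function.leftLim x.toFun a - z := by
      rcases F.eq_empty_or_nonempty with rfl | hF
      · simp only [Finset.sum_empty, sub_nonneg]
        rcases eq_or_neBot (𝓝[<] a) with h | h
        · rw [leftLim_eq_of_eq_bot _ h]; exact hz a
        · obtain ⟨b, hb⟩ := h.nonempty_of_mem self_mem_nhdsWithin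
          exact (hz b).trans (x.mono.le_leftLim hb)
      · have hm := F.max'_mem hF
        have h1 := ih (F.max' hF) (fun s hs => F.le_max' s hs)
        have h2 := x.mono.le_leftLim (ha _ hm)
        linarith
    have h3 := x.mono hat
    have h4 : x.jump a = x a - Function.leftLim x.toFun a := rfl
    linarith

lemma summable_jump (x : SubPath T) : Summable x.jump := by
  by_cases hT : 0 ≤ T
  · refine summable_of_sum_le (c := x ⟨T, hT, le_rfl⟩ - x ⟨0, le_rfl, hT⟩) x.jump_nonneg
      fun F => ?_
    exact x.sum_jump_le _ (fun s => x.mono s.2.1) F _ (fun s _ => s.2.2)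
  · have : IsEmpty (Icc (0 : ℝ) T) := ⟨fun s => hT (s.2.1.trans s.2.2)⟩
    exact (hasSum_empty).summable

/-- The contribution to the thinned path at time `t` of the jump at time `s`. -/
noncomputable def thinTerm (x : SubPath T) (u : x.jumpTimes → Bool) (t : Icc (0 : ℝ) T)
    (s : x.jumpTimes) : ℝ :=
  if (s : Icc (0 : ℝ) T) ≤ t ∧ u s = true then x.jump s else 0

lemma thinTerm_nonneg (x : SubPath T) (u : x.jumpTimes → Bool) (t : Icc (0 : ℝ) T)
    (s : x.jumpTimes) : 0 ≤ x.thinTerm u t s := by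
  unfold thinTerm; split_ifs
  exacts [x.jump_nonneg _, le_rfl]

lemma thinTerm_le (x : SubPath T) (u : x.jumpTimes → Bool) (t : Icc (0 : ℝ) T)
    (s : x.jumpTimes) : x.thinTerm u t s ≤ x.jump s := by
  unfold thinTerm; split_ifs
  exacts [le_rfl, x.jump_nonneg _]

lemma summable_thinTerm (x : SubPath T) (u : x.jumpTimes → Bool) (t : Icc (0 : ℝ) T) :
    Summable (x.thinTerm u t) :=
  Summable.of_nonneg_of_le (x.thinTerm_nonneg u t) (x.thinTerm_le u t)
    (x.summable_jump.subtype _)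

/-- The thinned path `t ↦ ∑_{s ≤ t, Δx_s > 0} u_s Δx_s`, where the jump at time `s` is kept if the
mark `u s` is `true` (`u_s = 1`) and deleted if it is `false` (`u_s = 0`). -/
noncomputable def thin (x : SubPath T) (u : x.jumpTimes → Bool) : SubPath T where
  toFun t := ∑' s : x.jumpTimes, x.thinTerm u t s
  mono t t' h := by
    refine (x.summable_thinTerm u t).tsum_le_tsum (fun s => ?_) (x.summable_thinTerm u t')
    by_cases hs : (s : Icc (0 : ℝ) T) ≤ t ∧ u s = true
    · simp [thinTerm, hs, hs.1.trans h]
    · rw [thinTerm, if_neg hs]; exact x.thinTerm_nonneg u t' s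
  rightCts t := by
    refine tendsto_tsum_of_dominated_convergence (bound := fun s : x.jumpTimes => x.jump s)
      (x.summable_jump.subtype _) (fun s => ?_) (Eventually.of_forall fun t' s => ?_)
    · refine tendsto_const_nhds.congr' ?_
      by_cases hs : (s : Icc (0 : ℝ) T) ≤ t
      · filter_upwards [self_mem_nhdsWithin] with t' ht'
        simp [thinTerm, hs, hs.trans ht']
      · filter_upwards [mem_nhdsWithin_of_mem_nhds (Iio_mem_nhds (not_le.1 hs))] with t' ht'
        have h' : ¬ (s : Icc (0 : ℝ) T) ≤ t' := not_le.2 (mem_Iio.1 ht')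
        simp [thinTerm, hs, h']
    · rw [Real.norm_of_nonneg (x.thinTerm_nonneg u t' s)]
      exact x.thinTerm_le u t' s
  start t ht := by
    have h0 : ∀ s : x.jumpTimes, x.thinTerm u t s = 0 := by
      rintro ⟨s, hs⟩
      unfold thinTerm
      rw [if_neg]
      rintro ⟨hst, -⟩
      have hbot : IsBot s := fun r => by
        have h1 : (s : ℝ) ≤ t := hst
        exact Subtype.coe_le_coe.1 ((h1.trans ht.le).trans r.2.1)
      have h2 : (0 : ℝ) < x s - Function.leftLim x.toFun s := hs
      rw [leftLim_eq_of_isBot hbot, sub_self] at h2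
      exact lt_irrefl _ h2
    simp [h0]

end SubPath

/-- `P` is the law, on the space of paths on `[0, T]`, of a Gamma process with shape parameter
`β` and rate parameter `α`: under `P` the path has independent increments, and the increment over
`[s, t]` is gamma distributed with shape `β (t - s)` and rate `α`. -/
structure IsGammaProcessLaw (T α β : ℝ) (P : Measure (SubPath T)) : Prop where
  isProbabilityMeasure : IsProbabilityMeasure P
  indepIncrements : HasIndepIncrements (fun (t : Icc (0 : ℝ) T) (x : SubPath T) => x t) P
  gammaIncrements : ∀ s t : Icc (0 : ℝ) T, s < t →
    HasLaw (fun x : SubPath T => x t - x s) (gammaMeasure (β * ((t : ℝ) - s)) α) P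

/-- The success probability `β' / β` of the marks, for `β' ≤ β`. -/
noncomputable def thinProb (β β' : Ioi (0 : ℝ)) (h : β' ≤ β) : unitInterval :=
  ⟨(β' : ℝ) / β, div_nonneg (le_of_lt β'.2) (le_of_lt β.2), div_le_one_of_le₀ h (le_of_lt β.2)⟩

open Classical in
/-- The proposal `Q_{β, β'}(x; ·)`, where `P b` is the law of the Gamma process with shape
parameter `b`. For `β < β'` it is the law of `x + X'` with `X'` distributed according to
`P (β' - β)`; for `β' < β` it is the law of `∑_{s ≤ t} U_s Δx_s` with `U_s` independent
Bernoulli variables, indexed by the jump times of `x`, of success probability `β' / β`; for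
`β' = β` the path is left unchanged. -/
noncomputable def gammaProposal {T : ℝ} (P : Ioi (0 : ℝ) → Measure (SubPath T))
    (β β' : Ioi (0 : ℝ)) (x : SubPath T) : Measure (SubPath T) :=
  if h : β < β' then
    (P ⟨(β' : ℝ) - β, mem_Ioi.2 (sub_pos.2 (Subtype.coe_lt_coe.2 h))⟩).map (fun x' => x + x')
  else if h : β' < β then
    (Measure.infinitePi
      (fun _ : x.jumpTimes => bernoulliMeasure true false (thinProb β β' h.le))).map x.thin
  else Measure.dirac x

/-- Lebesgue measure on the set `(0, ∞)` of shape parameters. -/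
noncomputable def shapeVolume : Measure (Ioi (0 : ℝ)) := Measure.comap Subtype.val volume

/-! For `β' < β`, both sides of the balance equation are the law of `(Y + Z, Y)` with independent `Y
∼ P β'` and `Z ∼ P (β - β')`. On the right this is how the additive proposal is built. On the left
it is the splitting of a Gamma process by independent marks on its jumps. The case `β < β'` is the
same statement with the two paths exchanged, and `β = β'` is the diagonal.

The splitting is proved without a Poisson random measure, through joint Laplace transforms. The
moments of the coordinates `e^{-x t}`, which lie in `[0, 1]`, determine a law (`ext_of_moments`);
their measurability in a parameter gives measurability of a kernel (`measurable_of_moments`). For a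
fixed path, the Laplace transform of the thinning is the limit, along partitions, of products of `1
- p + p e^{-w Δ}` over the increments `Δ` of the pure jump part (`tendsto_discreteThin`). A Gamma
path almost surely equals its pure jump part (`ae_jumpPart_eq`), so for it the increments of the
path itself may be used; these are independent.

On a cell of length `d`, integration then yields the arithmetic mean `(1 - p) e^{-βdu} + p
e^{-βdv}`, whereas the law of `(Y + Z, Y)` yields the geometric mean `e^{-βd((1 - p)u + pv)}`. The
two differ by `O(d²)`, so the products differ by `O(mesh)` and have the same limit
(`integral_prod_exp_mul_integral_thin`). Symmetry of the measure follows from balance at fixed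
parameters and Tonelli's theorem. -/

/-! ### Probability laws and mixed moments -/

section Moments

variable {A Ω ι : Type*} [MeasurableSpace A] [mΩ : MeasurableSpace Ω] {κ : A → Measure Ω}
  [∀ a, IsProbabilityMeasure (κ a)] {f : ι → Ω → unitInterval}

/-- Bounded convergence, applied for each parameter. It carries measurability from polynomials to
continuous functions, and from those to indicators. -/
lemma measurable_integral_of_tendsto {g : ℕ → Ω → ℝ} {g' : Ω → ℝ} {C : ℝ}
    (hg : ∀ n, Measurable (g n)) (hC : ∀ n ω, |g n ω| ≤ C)
    (hlim : ∀ ω, Tendsto (fun n => g n ω) atTop (𝓝 (g' ω)))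
    (h : ∀ n, Measurable fun a => ∫ ω, g n ω ∂κ a) :
    Measurable fun a => ∫ ω, g' ω ∂κ a := by
  refine measurable_of_tendsto_metrizable h (tendsto_pi_nhds.2 fun a => ?_)
  exact tendsto_integral_of_dominated_convergence (fun _ => C)
    (fun n => (hg n).aestronglyMeasurable) (integrable_const _)
    (fun n => Eventually.of_forall fun ω => hC n ω) (Eventually.of_forall hlim)

lemma integrable_prod_pow (μ : Measure Ω) [IsFiniteMeasure μ] (hf : ∀ i, Measurable (f i))
    (s : Finset ι) (n : ι → ℕ) : Integrable (fun ω => ∏ i ∈ s, (f i ω : ℝ) ^ n i) μ := by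
  refine Integrable.of_bound (C := 1) (Measurable.aestronglyMeasurable (by fun_prop))
    (Eventually.of_forall fun ω => ?_)
  rw [Real.norm_of_nonneg (Finset.prod_nonneg fun i _ => pow_nonneg (f i ω).2.1 _)]
  exact Finset.prod_le_one (fun i _ => pow_nonneg (f i ω).2.1 _)
    fun i _ => pow_le_one₀ (f i ω).2.1 (f i ω).2.2

lemma measurable_integral_prod_polynomial (hf : ∀ i, Measurable (f i))
    (h : ∀ (s : Finset ι) (n : ι → ℕ), Measurable fun a => ∫ ω, ∏ i ∈ s, (f i ω : ℝ) ^ n i ∂κ a)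
    (s : Finset ι) (p : ι → Polynomial ℝ) :
    Measurable fun a => ∫ ω, ∏ i ∈ s, (p i).eval (f i ω : ℝ) ∂κ a := by
  classical
  have key : ∀ ω, ∏ i ∈ s, (p i).eval (f i ω : ℝ)
      = ∑ q ∈ s.pi (fun i => Finset.range ((p i).natDegree + 1)),
        (∏ i ∈ s.attach, (p i).coeff (q i i.2)) *
          ∏ i ∈ s, (f i ω : ℝ) ^ (if hi : i ∈ s then q i hi else 0) := by
    intro ω
    simp_rw [Polynomial.eval_eq_sum_range]
    rw [Finset.prod_sum]
    refine Finset.sum_congr rfl fun q _ => ?_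
    rw [Finset.prod_mul_distrib, ← Finset.prod_attach s]
    simp
  simp_rw [key]
  have : ∀ a, ∫ ω, ∑ q ∈ s.pi (fun i => Finset.range ((p i).natDegree + 1)),
        (∏ i ∈ s.attach, (p i).coeff (q i i.2)) *
          ∏ i ∈ s, (f i ω : ℝ) ^ (if hi : i ∈ s then q i hi else 0) ∂κ a
      = ∑ q ∈ s.pi (fun i => Finset.range ((p i).natDegree + 1)),
        (∏ i ∈ s.attach, (p i).coeff (q i i.2)) *
          ∫ ω, ∏ i ∈ s, (f i ω : ℝ) ^ (if hi : i ∈ s then q i hi else 0) ∂κ a := by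
    intro a
    rw [integral_finsetSum _ fun q _ => (integrable_prod_pow _ hf _ _).const_mul _]
    simp_rw [integral_const_mul]
  simp_rw [this]
  exact Finset.measurable_sum _ fun q _ => (h _ _).const_mul _

/-- Weierstrass approximation in each factor. An error of at most `1` per factor keeps the products
bounded by `∏ (‖g i‖ + 1)`. -/
lemma measurable_integral_prod_continuous (hf : ∀ i, Measurable (f i))
    (h : ∀ (s : Finset ι) (n : ι → ℕ), Measurable fun a => ∫ ω, ∏ i ∈ s, (f i ω : ℝ) ^ n i ∂κ a)
    (s : Finset ι) (g : ι → C(unitInterval, ℝ)) :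
    Measurable fun a => ∫ ω, ∏ i ∈ s, g i (f i ω) ∂κ a := by
  have hp : ∀ (m : ℕ) (i : ι), ∃ p : Polynomial ℝ,
      ‖p.toContinuousMapOn (Icc 0 1) - g i‖ < 1 / ((m : ℝ) + 1) := fun m i =>
    exists_polynomial_near_continuousMap 0 1 (g i) _ (by positivity)
  choose p hp using hp
  have hd : ∀ m i (y : unitInterval), |(p m i).eval (y : ℝ) - g i y| ≤ 1 / ((m : ℝ) + 1) := by
    intro m i y
    have := ContinuousMap.norm_coe_le_norm ((p m i).toContinuousMapOn (Icc 0 1) - g i) y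
    simp only [ContinuousMap.sub_apply, Real.norm_eq_abs] at this
    exact this.trans (hp m i).le
  refine measurable_integral_of_tendsto (C := ∏ i ∈ s, (‖g i‖ + 1))
    (g := fun m ω => ∏ i ∈ s, (p m i).eval (f i ω : ℝ)) (fun m => ?_) (fun m ω => ?_) (fun ω => ?_)
    fun m => measurable_integral_prod_polynomial hf h s (p m)
  · refine Finset.measurable_prod _ fun i _ => ?_
    exact (p m i).continuous.measurable.comp (measurable_subtype_coe.comp (hf i))
  · rw [Finset.abs_prod]
    refine Finset.prod_le_prod (fun _ _ => abs_nonneg _) fun i _ => ?_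
    have h1 := hd m i (f i ω)
    have h2 : |g i (f i ω)| ≤ ‖g i‖ := ContinuousMap.norm_coe_le_norm (g i) _
    have h3 : 1 / ((m : ℝ) + 1) ≤ 1 := by
      rw [div_le_one (by positivity)]; linarith [(Nat.cast_nonneg m : (0 : ℝ) ≤ m)]
    have h4 := abs_sub_abs_le_abs_sub ((p m i).eval (f i ω : ℝ)) (g i (f i ω))
    linarith
  · refine tendsto_finsetProd _ fun i _ => ?_
    rw [tendsto_iff_dist_tendsto_zero]
    exact squeeze_zero (fun _ => dist_nonneg) (fun m => hd m i (f i ω))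
      tendsto_one_div_add_atTop_nhds_zero_nat

/-- A continuous approximation of the indicator function of `[c, 1]`. -/
def rampUp (c : unitInterval) (m : ℕ) : C(unitInterval, ℝ) where
  toFun y := max 0 (1 - m * max 0 ((c : ℝ) - y))
  continuous_toFun := by fun_prop

lemma rampUp_nonneg (c : unitInterval) (m : ℕ) (y : unitInterval) : 0 ≤ rampUp c m y :=
  le_max_left _ _

lemma rampUp_le_one (c : unitInterval) (m : ℕ) (y : unitInterval) : rampUp c m y ≤ 1 :=
  max_le zero_le_one (sub_le_self _ (by positivity))

lemma tendsto_rampUp (c y : unitInterval) :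
    Tendsto (fun m => rampUp c m y) atTop (𝓝 ((Ici c).indicator 1 y)) := by
  by_cases hy : c ≤ y
  · have : ∀ m, rampUp c m y = 1 := fun m => by
      have h1 : (c : ℝ) - y ≤ 0 := sub_nonpos.2 hy
      simp [rampUp, max_eq_left h1]
    simp [this, hy]
  · rw [indicator_of_notMem (by simpa using hy)]
    have hc : 0 < (c : ℝ) - y := sub_pos.2 (not_le.1 hy)
    refine tendsto_const_nhds.congr' ?_
    obtain ⟨m₀, hm₀⟩ := exists_nat_gt (1 / ((c : ℝ) - y))
    filter_upwards [eventually_ge_atTop m₀] with m hm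
    have h1 : 1 < m * ((c : ℝ) - y) := by
      rw [div_lt_iff₀ hc] at hm₀
      have : (m₀ : ℝ) ≤ m := by exact_mod_cast hm
      nlinarith
    have h2 : max 0 ((c : ℝ) - y) = c - y := max_eq_right hc.le
    simp only [rampUp, ContinuousMap.coe_mk, h2]
    rw [max_eq_left (by linarith)]

/-- A family of probability measures is measurable as soon as the mixed moments of a family of
`[0, 1]`-valued functions generating the `σ`-algebra are. -/
theorem measurable_of_moments (hgen : mΩ = ⨆ i, MeasurableSpace.comap (f i) inferInstance)
    (h : ∀ (s : Finset ι) (n : ι → ℕ), Measurable fun a => ∫ ω, ∏ i ∈ s, (f i ω : ℝ) ^ n i ∂κ a) :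
    Measurable κ := by
  have hf : ∀ i, Measurable (f i) := fun i => by
    rw [measurable_iff_comap_le, hgen]
    exact le_iSup (fun i => MeasurableSpace.comap (f i) inferInstance) i
  let π : ι → Set (Set Ω) := fun i => range fun c : unitInterval => f i ⁻¹' Ici c
  have hπ : ∀ i, MeasurableSpace.generateFrom (π i)
      = MeasurableSpace.comap (f i) inferInstance := by
    intro i
    rw [BorelSpace.measurable_eq (α := unitInterval), borel_eq_generateFrom_Ici,
      MeasurableSpace.comap_generateFrom, ← range_comp]
    rfl
  refine Measurable.measure_of_isPiSystem_of_isProbabilityMeasure (S := piiUnionInter π univ)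
    (le_antisymm ?_ ?_) (isPiSystem_piiUnionInter π (fun i => ?_) univ) ?_
  · conv_lhs => rw [hgen]
    refine iSup_le fun i => ?_
    rw [← hπ i]
    exact MeasurableSpace.generateFrom_mono (subset_piiUnionInter (mem_univ i))
  · refine generateFrom_piiUnionInter_le π (fun i => ?_) univ
    rw [hπ]
    exact (hf i).comap_le
  · rintro _ ⟨c, rfl⟩ _ ⟨d, rfl⟩ -
    refine ⟨c ⊔ d, ?_⟩
    ext; simp
  · rintro _ ⟨s, -, t, ht, rfl⟩
    have : ∀ i, ∃ c : unitInterval, i ∈ s → f i ⁻¹' Ici c = t i := fun i => by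
      by_cases hi : i ∈ s
      · obtain ⟨c, hc⟩ := ht i hi
        exact ⟨c, fun _ => hc⟩
      · exact ⟨0, fun h => absurd h hi⟩
    choose c hc using this
    have hms : MeasurableSet (⋂ i ∈ s, t i) := Finset.measurableSet_biInter _ fun i hi => by
      rw [← hc i hi]; exact hf i measurableSet_Ici
    have hind : ∀ ω, (⋂ i ∈ s, t i).indicator (1 : Ω → ℝ) ω
        = ∏ i ∈ s, (Ici (c i)).indicator 1 (f i ω) := by
      intro ω
      by_cases hω : ω ∈ ⋂ i ∈ s, t i
      · rw [indicator_of_mem hω, Finset.prod_eq_one]; · rfl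
        intro i hi
        have : ω ∈ f i ⁻¹' Ici (c i) := by rw [hc i hi]; exact mem_iInter₂.1 hω i hi
        exact indicator_of_mem (s := Ici (c i)) this 1
      · rw [indicator_of_notMem hω]
        simp only [mem_iInter, not_forall] at hω
        obtain ⟨i, hi, hω⟩ := hω
        rw [← hc i hi] at hω
        exact (Finset.prod_eq_zero hi (indicator_of_notMem (s := Ici (c i)) hω 1)).symm
    have hm : Measurable fun a => ∫ ω, (⋂ i ∈ s, t i).indicator (1 : Ω → ℝ) ω ∂κ a := by
      refine measurable_integral_of_tendsto (C := 1)
        (g := fun m ω => ∏ i ∈ s, rampUp (c i) m (f i ω)) (fun m => ?_) (fun m ω => ?_)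
        (fun ω => ?_) fun m => measurable_integral_prod_continuous hf h s fun i => rampUp (c i) m
      · exact Finset.measurable_prod _ fun i _ => (rampUp (c i) m).continuous.measurable.comp (hf i)
      · rw [abs_of_nonneg (Finset.prod_nonneg fun i _ => rampUp_nonneg _ _ _)]
        exact Finset.prod_le_one (fun i _ => rampUp_nonneg _ _ _) fun i _ => rampUp_le_one _ _ _
      · rw [hind]
        exact tendsto_finsetProd _ fun i _ => tendsto_rampUp _ _
    have : (fun a => κ a (⋂ i ∈ s, t i))
        = fun a => ENNReal.ofReal (∫ ω, (⋂ i ∈ s, t i).indicator (1 : Ω → ℝ) ω ∂κ a) := by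
      ext a
      rw [integral_indicator_one hms, ofReal_measureReal]
    rw [this]
    exact hm.ennreal_ofReal

/-- Two probability measures with the same mixed moments of a family of `[0, 1]`-valued functions
generating the `σ`-algebra are equal. -/
theorem ext_of_moments {μ ν : Measure Ω} [IsProbabilityMeasure μ] [IsProbabilityMeasure ν]
    (hgen : mΩ = ⨆ i, MeasurableSpace.comap (f i) inferInstance)
    (h : ∀ (s : Finset ι) (n : ι → ℕ),
      ∫ ω, ∏ i ∈ s, (f i ω : ℝ) ^ n i ∂μ = ∫ ω, ∏ i ∈ s, (f i ω : ℝ) ^ n i ∂ν) : μ = ν := by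
  let κ : Bool → Measure Ω := fun b => if b then μ else ν
  have : ∀ b, IsProbabilityMeasure (κ b) := by
    rintro (_ | _) <;> simp only [κ] <;> infer_instance
  -- With the trivial `σ`-algebra on `Bool`, a measurable function is constant, so measurability of
  -- `κ` amounts to `μ = ν`.
  have hκ : @Measurable Bool (Measure Ω) ⊥ _ κ := by
    refine @measurable_of_moments Bool Ω ι ⊥ mΩ κ this f hgen fun s n => ?_
    have : (fun b => ∫ ω, ∏ i ∈ s, (f i ω : ℝ) ^ n i ∂κ b)
        = fun _ => ∫ ω, ∏ i ∈ s, (f i ω : ℝ) ^ n i ∂ν := by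
      ext (_ | _) <;> simp [κ, h]
    rw [this]
    exact @measurable_const _ _ _ ⊥ _
  refine Measure.ext fun S hS => ?_
  have h1 : @Measurable Bool ENNReal ⊥ _ fun b => κ b S := (Measure.measurable_coe hS).comp hκ
  have h2 := h1 (measurableSet_singleton (κ true S))
  rw [MeasurableSpace.measurableSet_bot_iff] at h2
  rcases h2 with h2 | h2
  · exact absurd (show true ∈ (∅ : Set Bool) from h2 ▸ rfl) (by simp)
  · have : false ∈ (fun b => κ b S) ⁻¹' {κ true S} := by rw [h2]; trivial
    exact (show κ false S = κ true S from this).symm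

end Moments

/-! ### Partitions of the time interval and summation by parts -/

section Partitions

variable {T : ℝ}

/-- `τ 0 ≤ ⋯ ≤ τ N` is a partition of `[0, T]` of mesh at most `δ` that contains the points of
`s`. -/
structure IsPartition (s : Finset (Icc (0 : ℝ) T)) (δ : ℝ) (N : ℕ) (τ : ℕ → Icc (0 : ℝ) T) :
    Prop where
  mono : Monotone τ
  zero : (τ 0 : ℝ) = 0
  last : (τ N : ℝ) = T
  mem : ∀ t ∈ s, ∃ i, τ i = t
  mesh : ∀ i, (τ (i + 1) : ℝ) - τ i ≤ δ

namespace IsPartition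

variable {s : Finset (Icc (0 : ℝ) T)} {δ : ℝ} {N : ℕ} {τ : ℕ → Icc (0 : ℝ) T}

lemma zero_le (h : IsPartition s δ N τ) (t : Icc (0 : ℝ) T) : τ 0 ≤ t :=
  Subtype.coe_le_coe.1 (h.zero.le.trans t.2.1)

lemma le_last (h : IsPartition s δ N τ) (t : Icc (0 : ℝ) T) : t ≤ τ N :=
  Subtype.coe_le_coe.1 (t.2.2.trans h.last.ge)

lemma exists_mem_Ioc (h : IsPartition s δ N τ) {t : Icc (0 : ℝ) T} (ht : 0 < (t : ℝ)) :
    ∃ i, i < N ∧ τ i < t ∧ t ≤ τ (i + 1) := by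
  classical
  have hex : ∃ j, t ≤ τ j := ⟨N, h.le_last t⟩
  have h0 : Nat.find hex ≠ 0 := fun h0 => by
    have := Nat.find_spec hex
    rw [h0] at this
    have h1 : (t : ℝ) ≤ τ 0 := this
    rw [h.zero] at h1
    linarith
  obtain ⟨i, hi⟩ := Nat.exists_eq_succ_of_ne_zero h0
  have h1 : Nat.find hex ≤ N := Nat.find_le (h.le_last t)
  refine ⟨i, by omega, not_le.1 (Nat.find_min hex (by omega)), ?_⟩
  have := Nat.find_spec hex
  rwa [hi] at this

lemma eq_of_mem_Ioc (h : IsPartition s δ N τ) {t : Icc (0 : ℝ) T} {i j : ℕ} (hi : τ i < t)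
    (hi' : t ≤ τ (i + 1)) (hj : τ j < t) (hj' : t ≤ τ (j + 1)) : i = j := by
  have h1 : i < j + 1 := h.mono.reflect_lt (hi.trans_le hj')
  have h2 : j < i + 1 := h.mono.reflect_lt (hj.trans_le hi')
  omega

lemma le_of_lt (h : IsPartition s δ N τ) {t : Icc (0 : ℝ) T} (ht : t ∈ s) {i : ℕ}
    (hi : τ i < t) : τ (i + 1) ≤ t := by
  obtain ⟨j, rfl⟩ := h.mem t ht
  exact h.mono (Nat.succ_le_of_lt (h.mono.reflect_lt hi))

lemma exists_insert [DecidableEq (Icc (0 : ℝ) T)] (h : IsPartition s δ N τ) (t : Icc (0 : ℝ) T) :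
    ∃ N' τ', IsPartition (insert t s) δ N' τ' := by
  rcases eq_or_lt_of_le t.2.1 with ht | ht
  · refine ⟨N, τ, h.mono, h.zero, h.last, fun r hr => ?_, h.mesh⟩
    rcases Finset.mem_insert.1 hr with rfl | hr
    · exact ⟨0, Subtype.ext (h.zero.trans ht)⟩
    · exact h.mem r hr
  obtain ⟨i, hiN, hi, hi'⟩ := h.exists_mem_Ioc ht
  have hmono : ∀ j, τ j ≤ τ (j + 1) := fun j => h.mono j.le_succ
  -- The maximum is `t` at `j = i + 1`, since `τ i < t`, and the shifted old point afterwards, since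
  -- `t ≤ τ (i + 1)`.
  refine ⟨N + 1, fun j => if j ≤ i then τ j else t ⊔ τ (j - 1),
    monotone_nat_of_le_succ fun j => ?_, by simp [h.zero], ?_, fun r hr => ?_, fun j => ?_⟩
  · rcases lt_trichotomy j i with hj | rfl | hj
    · simpa [hj.le, Nat.succ_le_of_lt hj] using hmono j
    · simp
    · have h1 : ¬ j ≤ i := by omega
      have h2 : ¬ j + 1 ≤ i := by omega
      simp only [h1, h2, if_false]
      exact sup_le_sup le_rfl (h.mono (by omega))
  · have h1 : ¬ N + 1 ≤ i := by omega
    simp only [h1, if_false, Nat.add_sub_cancel, sup_of_le_right (h.le_last t), h.last]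
  · rcases Finset.mem_insert.1 hr with rfl | hr
    · exact ⟨i + 1, by simp [hi.le]⟩
    · obtain ⟨j, rfl⟩ := h.mem r hr
      by_cases hj : j ≤ i
      · exact ⟨j, by simp [hj]⟩
      · refine ⟨j + 1, ?_⟩
        have h1 : ¬ j + 1 ≤ i := by omega
        simp only [h1, if_false, Nat.add_sub_cancel]
        exact sup_of_le_right (hi'.trans (h.mono (by omega)))
  · have hi2 : (t : ℝ) ≤ τ (i + 1) := hi'
    have hi1 : (τ i : ℝ) < t := hi
    rcases lt_trichotomy j i with hj | rfl | hj
    · simpa [hj.le, Nat.succ_le_of_lt hj] using h.mesh j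
    · have := h.mesh j
      simp only [le_refl, if_true, show ¬ j + 1 ≤ j by omega, if_false, Nat.add_sub_cancel,
        sup_of_le_left hi.le]
      linarith
    · obtain ⟨l, rfl⟩ : ∃ l, j = l + 1 := ⟨j - 1, by omega⟩
      have h1 : ¬ l + 1 ≤ i := by omega
      have h2 : ¬ l + 1 + 1 ≤ i := by omega
      simp only [h1, h2, if_false, Nat.add_sub_cancel]
      have h3 := h.mesh l
      have h4 : t ≤ τ (l + 1) := hi'.trans (h.mono (by omega))
      rw [sup_of_le_right h4]
      have h5 : τ l ≤ t ⊔ τ l := le_sup_right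
      have h6 : (τ l : ℝ) ≤ (t ⊔ τ l : Icc (0 : ℝ) T) := h5
      linarith

lemma exists_of_finset (hT : 0 ≤ T) (s : Finset (Icc (0 : ℝ) T)) (hδ : 0 < δ) :
    ∃ N τ, IsPartition s δ N τ := by
  classical
  induction s using Finset.induction_on with
  | empty =>
    refine ⟨⌈T / δ⌉₊, fun j => ⟨min (j * δ) T, le_min (by positivity) hT, min_le_right _ _⟩,
      fun i j hij => ?_, by simpa using hT, ?_, by simp, fun i => ?_⟩
    · have : (i : ℝ) ≤ j := by exact_mod_cast hij
      exact Subtype.coe_le_coe.1 (min_le_min_right _ (by gcongr))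
    · exact min_eq_right ((div_le_iff₀ hδ).1 (Nat.le_ceil _))
    · push_cast
      rw [add_mul, one_mul]
      rcases le_total (i * δ) T with h | h
      · rw [min_eq_left h]; linarith [min_le_left (i * δ + δ) T]
      · rw [min_eq_right h]; linarith [min_le_right (i * δ + δ) T]
  | insert a s _ ih =>
    obtain ⟨N, τ, h⟩ := ih
    exact h.exists_insert a

lemma exists_seq (hT : 0 ≤ T) (s : Finset (Icc (0 : ℝ) T)) :
    ∃ (N : ℕ → ℕ) (τ : ℕ → ℕ → Icc (0 : ℝ) T),
      ∀ k : ℕ, IsPartition s (1 / ((k : ℝ) + 1)) (N k) (τ k) := by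
  choose N τ h using fun k : ℕ => exists_of_finset (δ := 1 / ((k : ℝ) + 1)) hT s (by positivity)
  exact ⟨N, τ, h⟩

lemma subset {s' : Finset (Icc (0 : ℝ) T)} (h : IsPartition s δ N τ) (hs : s' ⊆ s) :
    IsPartition s' δ N τ :=
  ⟨h.mono, h.zero, h.last, fun t ht => h.mem t (hs ht), h.mesh⟩

lemma sum_sub (h : IsPartition s δ N τ) :
    ∑ i ∈ Finset.range N, ((τ (i + 1) : ℝ) - τ i) = T := by
  rw [Finset.sum_range_sub (fun i => (τ i : ℝ)), h.zero, h.last, sub_zero]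

lemma sum_sub_apply_inf (h : IsPartition s δ N τ) (y : Icc (0 : ℝ) T → ℝ) (t : Icc (0 : ℝ) T) :
    ∑ i ∈ Finset.range N, (y (τ (i + 1) ⊓ t) - y (τ i ⊓ t)) = y t - y (τ 0) := by
  rw [Finset.sum_range_sub (fun i => y (τ i ⊓ t)), inf_of_le_right (h.le_last t),
    inf_of_le_left (h.zero_le t)]

end IsPartition

/-- The total weight of the points of `s` to the right of `r`. -/
noncomputable def tailWeight (s : Finset (Icc (0 : ℝ) T)) (n : Icc (0 : ℝ) T → ℕ)
    (r : Icc (0 : ℝ) T) : ℝ :=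
  ∑ t ∈ s, if r ≤ t then (n t : ℝ) else 0

lemma tailWeight_nonneg (s : Finset (Icc (0 : ℝ) T)) (n : Icc (0 : ℝ) T → ℕ)
    (r : Icc (0 : ℝ) T) : 0 ≤ tailWeight s n r :=
  Finset.sum_nonneg fun t _ => by split_ifs <;> positivity

lemma tailWeight_le (s : Finset (Icc (0 : ℝ) T)) (n : Icc (0 : ℝ) T → ℕ)
    (r : Icc (0 : ℝ) T) : tailWeight s n r ≤ ∑ t ∈ s, (n t : ℝ) :=
  Finset.sum_le_sum fun t _ => by split_ifs <;> simp

namespace IsPartition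

variable {s : Finset (Icc (0 : ℝ) T)} {δ : ℝ} {N : ℕ} {τ : ℕ → Icc (0 : ℝ) T}

/-- Points of `s` are partition points, so none lies strictly inside a cell and the tail weight is
constant on `(τ i, τ (i + 1)]`. -/
lemma tailWeight_eq (h : IsPartition s δ N τ) (n : Icc (0 : ℝ) T → ℕ) {i : ℕ}
    {r : Icc (0 : ℝ) T} (hr : τ i < r) (hr' : r ≤ τ (i + 1)) :
    tailWeight s n r = tailWeight s n (τ (i + 1)) := by
  refine Finset.sum_congr rfl fun t ht => ?_
  have : r ≤ t ↔ τ (i + 1) ≤ t := ⟨fun h' => h.le_of_lt ht (hr.trans_le h'), hr'.trans⟩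
  simp [this]

/-- Summation by parts: `y t` is the sum of the increments over the cells to the left of `t`. Each
cell lies wholly on one side of `t`, and exchanging the sums collects the weights `n t` into tail
weights. -/
lemma sum_mul_eq (h : IsPartition s δ N τ) (n : Icc (0 : ℝ) T → ℕ) (y : Icc (0 : ℝ) T → ℝ)
    (hy : y (τ 0) = 0) :
    ∑ t ∈ s, (n t : ℝ) * y t
      = ∑ i ∈ Finset.range N, tailWeight s n (τ (i + 1)) * (y (τ (i + 1)) - y (τ i)) := by
  simp only [tailWeight, Finset.sum_mul]
  rw [Finset.sum_comm]
  refine Finset.sum_congr rfl fun t ht => ?_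
  have h1 := h.sum_sub_apply_inf y t
  rw [hy, sub_zero] at h1
  rw [← h1, Finset.mul_sum]
  refine Finset.sum_congr rfl fun i _ => ?_
  by_cases hi : τ (i + 1) ≤ t
  · rw [if_pos hi, inf_of_le_left hi, inf_of_le_left ((h.mono i.le_succ).trans hi)]
  · have h2 : t ≤ τ i := not_lt.1 fun h' => hi (h.le_of_lt ht h')
    rw [if_neg hi, inf_of_le_right h2, inf_of_le_right (not_le.1 hi).le]
    simp

lemma prod_exp_eq (h : IsPartition s δ N τ) (n : Icc (0 : ℝ) T → ℕ) (y : Icc (0 : ℝ) T → ℝ)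
    (hy : y (τ 0) = 0) :
    ∏ t ∈ s, Real.exp (-y t) ^ n t = ∏ i ∈ Finset.range N,
      Real.exp (-(tailWeight s n (τ (i + 1)) * (y (τ (i + 1)) - y (τ i)))) := by
  rw [← Real.exp_sum, Finset.sum_neg_distrib, ← h.sum_mul_eq n y hy, ← Finset.sum_neg_distrib,
    Real.exp_sum]
  refine Finset.prod_congr rfl fun t _ => ?_
  rw [← Real.exp_nat_mul, mul_neg]

end IsPartition

end Partitions

/-! ### Continuous and pure jump parts of a path -/

namespace SubPath

variable {T : ℝ}

lemma eq_zero_of_isPartition (x : SubPath T) {s : Finset (Icc (0 : ℝ) T)} {δ : ℝ} {N : ℕ}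
    {τ : ℕ → Icc (0 : ℝ) T} (h : IsPartition s δ N τ) : x (τ 0) = 0 :=
  x.start _ h.zero

lemma apply_nonneg (x : SubPath T) (t : Icc (0 : ℝ) T) : 0 ≤ x t := by
  have h := x.mono (show (⟨0, le_rfl, t.2.1.trans t.2.2⟩ : Icc (0 : ℝ) T) ≤ t from t.2.1)
  rwa [x.start _ rfl] at h

@[ext]
lemma ext {x y : SubPath T} (h : ∀ t, x t = y t) : x = y := by
  cases x; cases y; congr; exact funext h

lemma measurable_toFun : Measurable (SubPath.toFun : SubPath T → _) :=
  comap_measurable _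

lemma measurable_apply (t : Icc (0 : ℝ) T) : Measurable fun x : SubPath T => x t :=
  (measurable_pi_apply t).comp measurable_toFun

lemma measurable_of_apply {A : Type*} [MeasurableSpace A] {g : A → SubPath T}
    (h : ∀ t, Measurable fun a => g a t) : Measurable g :=
  measurable_comap_iff.2 (measurable_pi_iff.2 h)

lemma add_apply (x y : SubPath T) (t : Icc (0 : ℝ) T) : (x + y) t = x t + y t := rfl

lemma pos_of_jumpTimes (x : SubPath T) (s : x.jumpTimes) : 0 < ((s : Icc (0 : ℝ) T) : ℝ) := by
  refine lt_of_le_of_ne s.1.2.1 fun h0 => ?_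
  have hbot : IsBot s.1 := fun r => Subtype.coe_le_coe.1 (h0.symm.le.trans r.2.1)
  have h2 : (0 : ℝ) < x s.1 - Function.leftLim x.toFun s.1 := s.2
  rw [leftLim_eq_of_isBot hbot, sub_self] at h2
  exact lt_irrefl _ h2

lemma summable_jumpTimes (x : SubPath T) : Summable fun s : x.jumpTimes => x.jump s :=
  x.summable_jump.subtype _

lemma countable_jumpTimes (x : SubPath T) : Countable x.jumpTimes := by
  refine (x.summable_jump.countable_support.mono fun s hs => ?_).to_subtype
  exact (ne_of_gt hs : x.jump s ≠ 0)

/-- Induction on the largest time `a`: the earlier jumps fit below the left limit at `a`, and the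
jump at `a` accounts for the rest. -/
lemma sum_jump_le_sub (x : SubPath T) (r : Icc (0 : ℝ) T) (F : Finset (Icc (0 : ℝ) T)) :
    (∀ s ∈ F, r < s) → ∀ t : Icc (0 : ℝ) T, r ≤ t → (∀ s ∈ F, s ≤ t) →
      ∑ s ∈ F, x.jump s ≤ x t - x r := by
  induction F using Finset.induction_on_max with
  | empty => intro _ t hrt _; simpa using x.mono hrt
  | insert a F ha ih =>
    intro hr t hrt ht
    have hat : a ≤ t := ht a (by simp)
    have hra : r < a := hr a (by simp)
    rw [Finset.sum_insert (fun h => lt_irrefl _ (ha a h))]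
    have hle : ∑ s ∈ F, x.jump s ≤ Function.leftLim x.toFun a - x r := by
      rcases F.eq_empty_or_nonempty with rfl | hF
      · simpa using x.mono.le_leftLim hra
      · have hm := F.max'_mem hF
        have h1 := ih (fun s hs => hr s (by simp [hs])) (F.max' hF)
          (hr _ (by simp [hm])).le (fun s hs => F.le_max' s hs)
        have h2 := x.mono.le_leftLim (ha _ hm)
        linarith
    have h3 := x.mono hat
    have h4 : x.jump a = x a - Function.leftLim x.toFun a := rfl
    linarith

/-- The sum of the weights `h s` of the jump times `s ≤ t`. -/
noncomputable def jumpSum (x : SubPath T) (h : x.jumpTimes → ℝ) (t : Icc (0 : ℝ) T) : ℝ :=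
  ∑' s : x.jumpTimes, if (s : Icc (0 : ℝ) T) ≤ t then h s else 0

lemma jumpSum_nonneg (x : SubPath T) {h : x.jumpTimes → ℝ} (h0 : ∀ s, 0 ≤ h s)
    (t : Icc (0 : ℝ) T) : 0 ≤ x.jumpSum h t :=
  tsum_nonneg fun s => by split_ifs; exacts [h0 s, le_rfl]

lemma summable_jumpSum (x : SubPath T) {h : x.jumpTimes → ℝ} (h0 : ∀ s, 0 ≤ h s)
    (hs : Summable h) (t : Icc (0 : ℝ) T) :
    Summable fun s : x.jumpTimes => if (s : Icc (0 : ℝ) T) ≤ t then h s else 0 :=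
  Summable.of_nonneg_of_le (fun s => by split_ifs; exacts [h0 s, le_rfl])
    (fun s => by split_ifs; exacts [le_rfl, h0 s]) hs

lemma jumpSum_le (x : SubPath T) {h : x.jumpTimes → ℝ} (h0 : ∀ s, 0 ≤ h s)
    (hs : Summable h) (t : Icc (0 : ℝ) T) : x.jumpSum h t ≤ ∑' s, h s :=
  (x.summable_jumpSum h0 hs t).tsum_le_tsum (fun s => by split_ifs; exacts [le_rfl, h0 s]) hs

lemma hasSum_jumpSum_sub (x : SubPath T) {h : x.jumpTimes → ℝ} (h0 : ∀ s, 0 ≤ h s)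
    (hs : Summable h) {r t : Icc (0 : ℝ) T} (hrt : r ≤ t) :
    HasSum (fun s : x.jumpTimes => if r < (s : Icc (0 : ℝ) T) ∧ (s : Icc (0 : ℝ) T) ≤ t
      then h s else 0) (x.jumpSum h t - x.jumpSum h r) := by
  refine ((x.summable_jumpSum h0 hs t).hasSum.sub (x.summable_jumpSum h0 hs r).hasSum).congr_fun
    fun s => ?_
  by_cases h1 : (s : Icc (0 : ℝ) T) ≤ r
  · simp [h1, h1.trans hrt, not_lt.2 h1]
  · simp [h1, not_le.1 h1]

lemma le_jumpSum_sub (x : SubPath T) {h : x.jumpTimes → ℝ} (h0 : ∀ s, 0 ≤ h s)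
    (hs : Summable h) {r t : Icc (0 : ℝ) T} (s : x.jumpTimes) (hr : r < s)
    (ht : (s : Icc (0 : ℝ) T) ≤ t) :
    h s ≤ x.jumpSum h t - x.jumpSum h r := by
  have := le_hasSum (x.hasSum_jumpSum_sub h0 hs (hr.le.trans ht)) s fun s' _ => by
    split_ifs; exacts [h0 s', le_rfl]
  simpa [hr, ht] using this

/-- The pure jump part of a path. -/
noncomputable def jumpPart (x : SubPath T) : SubPath T := x.thin fun _ => true

lemma jumpPart_apply (x : SubPath T) (t : Icc (0 : ℝ) T) :
    x.jumpPart t = x.jumpSum (fun s => x.jump s) t := by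
  simp [jumpPart, thin, jumpSum, thinTerm]

/-- The continuous part of a path. -/
noncomputable def contPart (x : SubPath T) (t : Icc (0 : ℝ) T) : ℝ := x t - x.jumpPart t

lemma jumpPart_sub_le (x : SubPath T) {r t : Icc (0 : ℝ) T} (hrt : r ≤ t) :
    x.jumpPart t - x.jumpPart r ≤ x t - x r := by
  classical
  rw [jumpPart_apply, jumpPart_apply]
  refine hasSum_le_of_sum_le
    (x.hasSum_jumpSum_sub (fun s => x.jump_nonneg s) x.summable_jumpTimes hrt) fun F => ?_
  rw [← Finset.sum_filter]
  have := x.sum_jump_le_sub r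
    ((F.filter fun s : x.jumpTimes => r < (s : Icc (0 : ℝ) T) ∧ (s : Icc (0 : ℝ) T) ≤ t).map
      (Function.Embedding.subtype _)) (by simp +contextual) t hrt (by simp +contextual)
  rw [Finset.sum_map] at this
  exact this

lemma contPart_mono (x : SubPath T) : Monotone x.contPart := fun r t hrt => by
  have := x.jumpPart_sub_le hrt
  simp only [contPart]
  linarith

lemma contPart_of_eq_zero (x : SubPath T) {t : Icc (0 : ℝ) T} (ht : (t : ℝ) = 0) :
    x.contPart t = 0 := by
  rw [contPart, x.start t ht, x.jumpPart.start t ht, sub_zero]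

lemma contPart_nonneg (x : SubPath T) (t : Icc (0 : ℝ) T) : 0 ≤ x.contPart t := by
  have h := x.contPart_mono
    (show (⟨0, le_rfl, t.2.1.trans t.2.2⟩ : Icc (0 : ℝ) T) ≤ t from t.2.1)
  rwa [x.contPart_of_eq_zero rfl] at h

/-- The increment of the jump part over `(r, t]` already contains the jump at `t`. As `r ↑ t` the
bound tends to zero, which gives left continuity. -/
lemma contPart_sub_le (x : SubPath T) {r t : Icc (0 : ℝ) T} (hrt : r < t) :
    x.contPart t - x.contPart r ≤ Function.leftLim x.toFun t - x r := by
  have h1 : x.jump t ≤ x.jumpPart t - x.jumpPart r := by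
    by_cases ht : 0 < x.jump t
    · rw [jumpPart_apply, jumpPart_apply]
      exact x.le_jumpSum_sub (fun s => x.jump_nonneg s) x.summable_jumpTimes ⟨t, ht⟩ hrt le_rfl
    · exact (not_lt.1 ht).trans (sub_nonneg.2 (x.jumpPart.mono hrt.le))
  have h2 : x.jump t = x t - Function.leftLim x.toFun t := rfl
  simp only [contPart]
  linarith

lemma continuous_contPart (x : SubPath T) : Continuous x.contPart := by
  refine continuous_iff_continuousAt.2 fun t => continuousAt_iff_continuous_left'_right'.2
    ⟨?_, ((x.rightCts t).sub (x.jumpPart.rightCts t)).mono Ioi_subset_Ici_self⟩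
  have h1 : Tendsto (fun r => Function.leftLim x.toFun t - x r) (𝓝[<] t) (𝓝 0) := by
    simpa using (x.mono.tendsto_leftLim t).const_sub (Function.leftLim x.toFun t)
  have h2 : Tendsto (fun r => x.contPart t - x.contPart r) (𝓝[<] t) (𝓝 0) := by
    refine tendsto_of_tendsto_of_tendsto_of_le_of_le' tendsto_const_nhds h1 ?_ ?_
    · filter_upwards [self_mem_nhdsWithin] with r hr
      exact sub_nonneg.2 (x.contPart_mono (le_of_lt hr))
    · filter_upwards [self_mem_nhdsWithin] with r hr
      exact x.contPart_sub_le hr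
  have h3 := h2.const_sub (x.contPart t)
  simpa [ContinuousWithinAt] using h3

lemma exists_mesh_contPart (x : SubPath T) {ε : ℝ} (hε : 0 < ε) :
    ∃ δ > 0, ∀ r t : Icc (0 : ℝ) T, r ≤ t → (t : ℝ) - r < δ → x.contPart t - x.contPart r ≤ ε := by
  obtain ⟨δ, hδ, h⟩ := Metric.uniformContinuous_iff.1
    (CompactSpace.uniformContinuous_of_continuous x.continuous_contPart) ε hε
  refine ⟨δ, hδ, fun r t hrt hd => ?_⟩
  have : dist t r < δ := by
    rw [Subtype.dist_eq, Real.dist_eq, abs_of_nonneg (sub_nonneg.2 (Subtype.coe_le_coe.2 hrt))]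
    exact hd
  exact (le_abs_self _).trans (h this).le

lemma inf_sub_inf_le {a b t : Icc (0 : ℝ) T} (hab : a ≤ b) :
    ((b ⊓ t : Icc (0 : ℝ) T) : ℝ) - (a ⊓ t : Icc (0 : ℝ) T) ≤ b - a := by
  rcases le_total b t with h | h
  · rw [inf_of_le_left h, inf_of_le_left (hab.trans h)]
  · rw [inf_of_le_right h]
    have h1 : (t : ℝ) ≤ b := h
    have h2 : (a : ℝ) ≤ b := hab
    rcases le_total a t with h' | h'
    · rw [inf_of_le_left h']; linarith
    · rw [inf_of_le_right h']; linarith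

/-- The sum of the increments of a path over a partition of `[0, t]`, each cut off at `ε`. -/
noncomputable def cutoffSum (ε : ℝ) (N : ℕ) (τ : ℕ → Icc (0 : ℝ) T) (t : Icc (0 : ℝ) T)
    (x : SubPath T) : ℝ :=
  ∑ i ∈ Finset.range N, min (x (τ (i + 1) ⊓ t) - x (τ i ⊓ t)) ε

lemma measurable_cutoffSum (ε : ℝ) (N : ℕ) (τ : ℕ → Icc (0 : ℝ) T) (t : Icc (0 : ℝ) T) :
    Measurable (cutoffSum ε N τ t) :=
  Finset.measurable_sum _ fun _ _ =>
    ((measurable_apply _).sub (measurable_apply _)).min measurable_const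

/-- On a fine partition the increments of the continuous part are at most `ε` by uniform continuity,
hence survive the cut-off, and they telescope. -/
lemma eventually_contPart_le_cutoffSum (x : SubPath T) {s : Finset (Icc (0 : ℝ) T)} {N : ℕ → ℕ}
    {τ : ℕ → ℕ → Icc (0 : ℝ) T} (h : ∀ k : ℕ, IsPartition s (1 / ((k : ℝ) + 1)) (N k) (τ k))
    {ε : ℝ} (hε : 0 < ε) (t : Icc (0 : ℝ) T) :
    ∀ᶠ k in atTop, x.contPart t ≤ cutoffSum ε (N k) (τ k) t x := by
  obtain ⟨δ, hδ, hC⟩ := x.exists_mesh_contPart hε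
  filter_upwards [tendsto_one_div_add_atTop_nhds_zero_nat.eventually (gt_mem_nhds hδ)] with k hk
  have h1 := (h k).sum_sub_apply_inf x.contPart t
  rw [x.contPart_of_eq_zero (h k).zero, sub_zero] at h1
  rw [← h1]
  refine Finset.sum_le_sum fun i _ => le_min ?_ ?_
  · have := x.jumpPart.mono (inf_le_inf_right t ((h k).mono i.le_succ))
    simp only [contPart]
    linarith
  · refine hC _ _ (inf_le_inf_right t ((h k).mono i.le_succ)) ?_
    exact ((inf_sub_inf_le ((h k).mono i.le_succ)).trans ((h k).mesh i)).trans_lt hk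

lemma min_hasSum_le {ι : Type*} {f : ι → ℝ} {a b ε : ℝ} (hε : 0 ≤ ε) (h0 : ∀ i, 0 ≤ f i)
    (hf : HasSum f a) (hf' : HasSum (fun i => min (f i) ε) b) : min a ε ≤ b := by
  by_cases h : ∃ i, ε ≤ f i
  · obtain ⟨i, hi⟩ := h
    have := le_hasSum hf' i fun j _ => le_min (h0 j) hε
    rw [min_eq_right hi] at this
    exact (min_le_right _ _).trans this
  · push Not at h
    have : (fun i => min (f i) ε) = f := funext fun i => min_eq_left (h i).le
    rw [this] at hf'
    exact (min_le_left _ _).trans (hf.unique hf').le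

/-- The cut-off `y ↦ min y ε` is countably subadditive on nonnegative terms, so cutting off a sum of
jumps costs no more than cutting off each jump. -/
lemma cutoffSum_le (x : SubPath T) {s : Finset (Icc (0 : ℝ) T)} {δ : ℝ} {N : ℕ}
    {τ : ℕ → Icc (0 : ℝ) T} (h : IsPartition s δ N τ) {ε : ℝ} (hε : 0 ≤ ε) (t : Icc (0 : ℝ) T) :
    cutoffSum ε N τ t x ≤ x.contPart t + ∑' s : x.jumpTimes, min (x.jump s) ε := by
  have h0 : ∀ s : x.jumpTimes, 0 ≤ min (x.jump s) ε := fun s => le_min (x.jump_nonneg s) hε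
  have hs : Summable fun s : x.jumpTimes => min (x.jump s) ε :=
    Summable.of_nonneg_of_le h0 (fun s => min_le_left _ _) x.summable_jumpTimes
  have h1 := h.sum_sub_apply_inf x.contPart t
  have h2 := h.sum_sub_apply_inf (x.jumpSum fun s => min (x.jump s) ε) t
  rw [x.contPart_of_eq_zero h.zero, sub_zero] at h1
  have h3 : cutoffSum ε N τ t x ≤ x.contPart t + (x.jumpSum (fun s => min (x.jump s) ε) t
      - x.jumpSum (fun s => min (x.jump s) ε) (τ 0)) := by
    rw [← h1, ← h2, ← Finset.sum_add_distrib]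
    refine Finset.sum_le_sum fun i _ => ?_
    have hle : τ i ⊓ t ≤ τ (i + 1) ⊓ t := inf_le_inf_right t (h.mono i.le_succ)
    have h4 := x.contPart_mono hle
    have h5 : min (x.jumpPart (τ (i + 1) ⊓ t) - x.jumpPart (τ i ⊓ t)) ε
        ≤ x.jumpSum (fun s => min (x.jump s) ε) (τ (i + 1) ⊓ t)
          - x.jumpSum (fun s => min (x.jump s) ε) (τ i ⊓ t) := by
      rw [jumpPart_apply, jumpPart_apply]
      refine min_hasSum_le hε (fun s => ?_)
        (x.hasSum_jumpSum_sub (fun s => x.jump_nonneg s) x.summable_jumpTimes hle)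
        ((x.hasSum_jumpSum_sub h0 hs hle).congr_fun fun s => ?_)
      · split_ifs; exacts [x.jump_nonneg s, le_rfl]
      · split_ifs; exacts [rfl, min_eq_left hε]
    have h6 : x (τ (i + 1) ⊓ t) - x (τ i ⊓ t) = (x.contPart (τ (i + 1) ⊓ t) - x.contPart (τ i ⊓ t))
        + (x.jumpPart (τ (i + 1) ⊓ t) - x.jumpPart (τ i ⊓ t)) := by
      simp only [contPart]; ring
    rw [h6]
    rcases le_total (x.jumpPart (τ (i + 1) ⊓ t) - x.jumpPart (τ i ⊓ t)) ε with h7 | h7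
    · rw [min_eq_left h7] at h5
      exact (min_le_left _ _).trans (by linarith)
    · rw [min_eq_right h7] at h5
      exact (min_le_right _ _).trans (by linarith)
  have h4 := x.jumpSum_le h0 hs t
  have h5 := x.jumpSum_nonneg h0 (τ 0)
  linarith

lemma tendsto_tsum_min_jump (x : SubPath T) :
    Tendsto (fun m : ℕ => ∑' s : x.jumpTimes, min (x.jump s) (1 / ((m : ℝ) + 1))) atTop (𝓝 0) := by
  have := tendsto_tsum_of_dominated_convergence (𝓕 := atTop)
    (f := fun (m : ℕ) (s : x.jumpTimes) => min (x.jump s) (1 / ((m : ℝ) + 1)))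
    (g := fun _ => (0 : ℝ)) (bound := fun s => x.jump s) x.summable_jumpTimes (fun s => ?_)
    (Eventually.of_forall fun m s => ?_)
  · simpa using this
  · have h1 := (tendsto_const_nhds (x := x.jump s)).min tendsto_one_div_add_atTop_nhds_zero_nat
    rwa [min_eq_right (x.jump_nonneg s)] at h1
  · rw [Real.norm_of_nonneg (le_min (x.jump_nonneg s) (by positivity))]
    exact min_le_left _ _

/-- The jump times depend on the path, so measurability is not visible from the definition. The
lower limit of the cut-off sums along partitions lies between the continuous part and the continuous
part plus `∑ min (x.jump s) ε`; the latter sum vanishes as `ε → 0`. -/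
lemma measurable_contPart (t : Icc (0 : ℝ) T) : Measurable fun x : SubPath T => x.contPart t := by
  obtain ⟨N, τ, h⟩ := IsPartition.exists_seq (t.2.1.trans t.2.2) (∅ : Finset (Icc (0 : ℝ) T))
  refine measurable_of_tendsto_metrizable (f := fun (m : ℕ) (x : SubPath T) =>
    liminf (fun k => cutoffSum (1 / ((m : ℝ) + 1)) (N k) (τ k) t x) atTop)
    (fun m => Measurable.liminf fun k => measurable_cutoffSum _ _ _ _)
    (tendsto_pi_nhds.2 fun x => ?_)
  have hup : Tendsto (fun m : ℕ =>
      x.contPart t + ∑' s : x.jumpTimes, min (x.jump s) (1 / ((m : ℝ) + 1))) atTop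
      (𝓝 (x.contPart t)) := by
    simpa using x.tendsto_tsum_min_jump.const_add (x.contPart t)
  have hle : ∀ m k : ℕ, cutoffSum (1 / ((m : ℝ) + 1)) (N k) (τ k) t x
      ≤ x.contPart t + ∑' s : x.jumpTimes, min (x.jump s) (1 / ((m : ℝ) + 1)) := fun m k =>
    x.cutoffSum_le (h k) (by positivity) t
  have hge : ∀ m : ℕ, ∀ᶠ k in atTop,
      x.contPart t ≤ cutoffSum (1 / ((m : ℝ) + 1)) (N k) (τ k) t x := fun m =>
    x.eventually_contPart_le_cutoffSum h (by positivity) t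
  refine tendsto_of_tendsto_of_tendsto_of_le_of_le tendsto_const_nhds hup (fun m => ?_)
    fun m => ?_
  · exact le_liminf_of_le (isBoundedUnder_of ⟨_, hle m⟩).isCoboundedUnder_ge (hge m)
  · exact liminf_le_of_frequently_le (Eventually.of_forall (hle m)).frequently ⟨_, hge m⟩

lemma measurable_jumpPart : Measurable (jumpPart : SubPath T → SubPath T) :=
  measurable_of_apply fun t => by
    have : (fun x : SubPath T => x.jumpPart t) = fun x => x t - x.contPart t := by
      ext x; simp [contPart]
    rw [this]
    exact (measurable_apply t).sub (measurable_contPart t)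

end SubPath

/-! ### Thinning factors -/

/-- The Laplace transform at `w` of a point mass at `y` that is kept with probability `p`. -/
noncomputable def thinFactor (p w y : ℝ) : ℝ := 1 - p + p * Real.exp (-(w * y))

section ThinFactor

variable {p w y z : ℝ}

lemma thinFactor_zero_right (p w : ℝ) : thinFactor p w 0 = 1 := by simp [thinFactor]

lemma thinFactor_nonneg (h0 : 0 ≤ p) (h1 : p ≤ 1) : 0 ≤ thinFactor p w y :=
  add_nonneg (sub_nonneg.2 h1) (mul_nonneg h0 (Real.exp_pos _).le)

lemma thinFactor_le_one (h0 : 0 ≤ p) (hw : 0 ≤ w) (hy : 0 ≤ y) : thinFactor p w y ≤ 1 := by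
  have : Real.exp (-(w * y)) ≤ 1 := Real.exp_le_one_iff.2 (neg_nonpos.2 (mul_nonneg hw hy))
  unfold thinFactor
  nlinarith

lemma thinFactor_anti (h0 : 0 ≤ p) (hw : 0 ≤ w) (hyz : y ≤ z) :
    thinFactor p w z ≤ thinFactor p w y := by
  unfold thinFactor
  gcongr

/-- With `a = e^{-wy}` and `b = e^{-wz}`, the difference of the two sides is `p (1 - p) (1 - a) (1 -
b)`. Merging two masses under a single mark raises the transform. -/
lemma thinFactor_mul_le (h0 : 0 ≤ p) (h1 : p ≤ 1) (hw : 0 ≤ w) (hy : 0 ≤ y) (hz : 0 ≤ z) :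
    thinFactor p w y * thinFactor p w z ≤ thinFactor p w (y + z) := by
  have ha : Real.exp (-(w * y)) ≤ 1 := Real.exp_le_one_iff.2 (neg_nonpos.2 (mul_nonneg hw hy))
  have hb : Real.exp (-(w * z)) ≤ 1 := Real.exp_le_one_iff.2 (neg_nonpos.2 (mul_nonneg hw hz))
  unfold thinFactor
  rw [mul_add w, neg_add, Real.exp_add]
  have := mul_nonneg (mul_nonneg h0 (sub_nonneg.2 h1))
    (mul_nonneg (sub_nonneg.2 ha) (sub_nonneg.2 hb))
  linarith

lemma prod_thinFactor_le {ι : Type*} (h0 : 0 ≤ p) (h1 : p ≤ 1) (hw : 0 ≤ w) {d : ι → ℝ}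
    (hd : ∀ i, 0 ≤ d i) (F : Finset ι) :
    ∏ i ∈ F, thinFactor p w (d i) ≤ thinFactor p w (∑ i ∈ F, d i) := by
  classical
  induction F using Finset.induction_on with
  | empty => simp [thinFactor_zero_right]
  | insert a F ha ih =>
    rw [Finset.prod_insert ha, Finset.sum_insert ha]
    exact (mul_le_mul_of_nonneg_left ih (thinFactor_nonneg h0 h1)).trans
      (thinFactor_mul_le h0 h1 hw (hd a) (Finset.sum_nonneg fun i _ => hd i))

lemma continuous_thinFactor : Continuous fun q : ℝ × ℝ × ℝ => thinFactor q.1 q.2.1 q.2.2 := by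
  unfold thinFactor; fun_prop

end ThinFactor

/-! ### Laplace transform of the thinning of a fixed path -/

lemma integral_prod_infinitePi {ι : Type*} {X : ι → Type*} [∀ i, MeasurableSpace (X i)]
    {μ : ∀ i, Measure (X i)} [∀ i, IsProbabilityMeasure (μ i)] {g : ∀ i, X i → ℝ}
    (hg : ∀ i, Measurable (g i)) (F : Finset ι) :
    ∫ u, ∏ i ∈ F, g i (u i) ∂Measure.infinitePi μ = ∏ i ∈ F, ∫ z, g i z ∂μ i := by
  have h1 : iIndepFun (fun (i : F) (u : ∀ i, X i) => g i (u i)) (Measure.infinitePi μ) :=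
    (iIndepFun_infinitePi (P := μ) hg).precomp (g := Subtype.val) Subtype.val_injective
  have h2 := h1.integral_fun_prod_eq_prod_integral
    fun i => ((hg i).comp (measurable_pi_apply _)).aestronglyMeasurable
  simp_rw [Finset.prod_coe_sort F (fun i => g i _)] at h2
  rw [Finset.prod_coe_sort F (fun i => ∫ u : ∀ i, X i, g i (u i) ∂Measure.infinitePi μ)] at h2
  rw [h2]
  refine Finset.prod_congr rfl fun i _ => ?_
  rw [← Measure.infinitePi_map_eval μ i, integral_map (measurable_pi_apply i).aemeasurable
    (hg i).aestronglyMeasurable]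

namespace SubPath

variable {T : ℝ}

/-- The law of independent Bernoulli marks at the jump times of a path. -/
noncomputable def marks (x : SubPath T) (p : unitInterval) : Measure (x.jumpTimes → Bool) :=
  Measure.infinitePi fun _ => bernoulliMeasure true false p

instance (x : SubPath T) (p : unitInterval) : IsProbabilityMeasure (x.marks p) := by
  unfold marks; infer_instance

lemma measurable_thin (x : SubPath T) : Measurable x.thin := by
  have := x.countable_jumpTimes
  refine measurable_of_apply fun t => ?_
  change Measurable fun u => ∑' s : x.jumpTimes, x.thinTerm u t s
  refine Measurable.tsum fun s => ?_
  exact (measurable_of_countable fun b : Bool =>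
    if (s : Icc (0 : ℝ) T) ≤ t ∧ b = true then x.jump s else 0).comp (measurable_pi_apply s)

lemma hasSum_thin (x : SubPath T) (u : x.jumpTimes → Bool) (s : Finset (Icc (0 : ℝ) T))
    (n : Icc (0 : ℝ) T → ℕ) :
    HasSum (fun r : x.jumpTimes => if u r = true then tailWeight s n r * x.jump r else 0)
      (∑ t ∈ s, (n t : ℝ) * x.thin u t) := by
  have h : ∀ t ∈ s, HasSum (fun r => (n t : ℝ) * x.thinTerm u t r) ((n t : ℝ) * x.thin u t) :=
    fun t _ => (x.summable_thinTerm u t).hasSum.mul_left _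
  refine (hasSum_sum h).congr_fun fun r => ?_
  by_cases hr : u r = true
  · simp only [hr, if_true, tailWeight, thinTerm, and_true, Finset.sum_mul]
    exact Finset.sum_congr rfl fun t _ => by split_ifs <;> simp
  · simp [hr, thinTerm]

/-- Independence of the marks gives the product over finitely many jumps; dominated convergence
along finite sets of jump times gives the limit. -/
lemma tendsto_prod_thinFactor (x : SubPath T) (p : unitInterval) (s : Finset (Icc (0 : ℝ) T))
    (n : Icc (0 : ℝ) T → ℕ) :
    Tendsto (fun F : Finset x.jumpTimes => ∏ r ∈ F, thinFactor p (tailWeight s n r) (x.jump r))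
      atTop (𝓝 (∫ u, ∏ t ∈ s, Real.exp (-x.thin u t) ^ n t ∂x.marks p)) := by
  -- Countability makes `atTop` on finite sets of jump times countably generated, as dominated
  -- convergence requires.
  have := x.countable_jumpTimes
  let g : x.jumpTimes → Bool → ℝ := fun r b =>
    if b = true then Real.exp (-(tailWeight s n r * x.jump r)) else 1
  have hg : ∀ r, Measurable (g r) := fun r => measurable_of_countable _
  have hg0 : ∀ r b, 0 ≤ g r b := fun r b => by
    simp only [g]; split_ifs; exacts [(Real.exp_pos _).le, zero_le_one]
  have hg1 : ∀ r b, g r b ≤ 1 := fun r b => by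
    simp only [g]
    split_ifs
    exacts [Real.exp_le_one_iff.2 (neg_nonpos.2
      (mul_nonneg (tailWeight_nonneg _ _ _) (x.jump_nonneg _))), le_rfl]
  have h1 : ∀ F : Finset x.jumpTimes, ∏ r ∈ F, thinFactor p (tailWeight s n r) (x.jump r)
      = ∫ u, ∏ r ∈ F, g r (u r) ∂x.marks p := by
    intro F
    rw [marks, integral_prod_infinitePi hg]
    refine Finset.prod_congr rfl fun r _ => ?_
    rw [integral_bernoulliMeasure]
    simp [g, thinFactor, add_comm]
  simp_rw [h1]
  refine tendsto_integral_filter_of_dominated_convergence (fun _ => 1)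
    (Eventually.of_forall fun F => ?_) (Eventually.of_forall fun F => ?_) (integrable_const _)
    (Eventually.of_forall fun u => ?_)
  · exact (Finset.measurable_prod _ fun r _ =>
      (hg r).comp (measurable_pi_apply r)).aestronglyMeasurable
  · refine Eventually.of_forall fun u => ?_
    rw [Real.norm_of_nonneg (Finset.prod_nonneg fun r _ => hg0 _ _)]
    exact Finset.prod_le_one (fun r _ => hg0 _ _) fun r _ => hg1 _ _
  · have h2 := (x.hasSum_thin u s n).neg
    have h3 : Tendsto _ atTop _ := (Real.continuous_exp.tendsto _).comp h2
    convert h3 using 1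
    · ext F
      simp only [Function.comp, Real.exp_sum, g]
      exact Finset.prod_congr rfl fun r _ => by split_ifs <;> simp
    · rw [← Finset.sum_neg_distrib, Real.exp_sum]
      congr 1
      exact Finset.prod_congr rfl fun t _ => by rw [← Real.exp_nat_mul, mul_neg]

section Discretization

variable {s : Finset (Icc (0 : ℝ) T)} {δ : ℝ} {N : ℕ} {τ : ℕ → Icc (0 : ℝ) T}

/-- The product of thinning factors of the increments of a path over a partition. -/
noncomputable def discreteThin (p : ℝ) (s : Finset (Icc (0 : ℝ) T)) (n : Icc (0 : ℝ) T → ℕ)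
    (N : ℕ) (τ : ℕ → Icc (0 : ℝ) T) (x : SubPath T) : ℝ :=
  ∏ i ∈ Finset.range N, thinFactor p (tailWeight s n (τ (i + 1))) (x (τ (i + 1)) - x (τ i))

/-- A partition marks all jumps of one cell together, which only raises the product by
`prod_thinFactor_le`. -/
lemma prod_thinFactor_le_discreteThin (x : SubPath T) (p : unitInterval)
    (h : IsPartition s δ N τ) (n : Icc (0 : ℝ) T → ℕ) :
    ∫ u, ∏ t ∈ s, Real.exp (-x.thin u t) ^ n t ∂x.marks p
      ≤ discreteThin p s n N τ x.jumpPart := by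
  classical
  choose idx hidx hidx1 hidx2 using fun r : x.jumpTimes => h.exists_mem_Ioc (x.pos_of_jumpTimes r)
  have hmem : ∀ (r : x.jumpTimes) (i : ℕ), (τ i < r ∧ (r : Icc (0 : ℝ) T) ≤ τ (i + 1)) ↔ idx r = i :=
    fun r i => ⟨fun hi => h.eq_of_mem_Ioc (hidx1 r) (hidx2 r) hi.1 hi.2,
      fun hi => hi ▸ ⟨hidx1 r, hidx2 r⟩⟩
  have hsum : ∀ i, HasSum (fun r : x.jumpTimes => if idx r = i then x.jump r else 0)
      (x.jumpPart (τ (i + 1)) - x.jumpPart (τ i)) := fun i => by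
    have := x.hasSum_jumpSum_sub (fun s => x.jump_nonneg s) x.summable_jumpTimes
      (h.mono i.le_succ)
    simp_rw [hmem] at this
    rwa [jumpPart_apply, jumpPart_apply]
  refine le_of_tendsto_of_tendsto' (x.tendsto_prod_thinFactor p s n)
    (tendsto_finsetProd (Finset.range N) fun i _ =>
      ((continuous_thinFactor.comp (by fun_prop : Continuous fun y : ℝ =>
        ((p : ℝ), tailWeight s n (τ (i + 1)), y))).tendsto _).comp (hsum i)) fun F => ?_
  rw [← Finset.prod_fiberwise_of_maps_to (t := Finset.range N) (g := idx)
    fun r _ => Finset.mem_range.2 (hidx r)]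
  refine Finset.prod_le_prod
    (fun i _ => Finset.prod_nonneg fun r _ => thinFactor_nonneg p.2.1 p.2.2) fun i _ => ?_
  have h1 : ∏ r ∈ F with idx r = i, thinFactor p (tailWeight s n r) (x.jump r)
      = ∏ r ∈ F with idx r = i, thinFactor p (tailWeight s n (τ (i + 1))) (x.jump r) :=
    Finset.prod_congr rfl fun r hr => by
      obtain ⟨h2, h3⟩ := (hmem r i).2 (Finset.mem_filter.1 hr).2
      rw [h.tailWeight_eq n h2 h3]
  rw [h1]
  simp only [Function.comp, ← Finset.sum_filter]
  exact prod_thinFactor_le p.2.1 p.2.2 (tailWeight_nonneg _ _ _) (fun r => x.jump_nonneg _) _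

/-- Jumps further apart than the mesh lie in distinct cells. Cells without a jump of `F` contribute
factors at most `1`; in the others the increment dominates the chosen jump. -/
lemma discreteThin_le_prod_thinFactor (x : SubPath T) (p : unitInterval)
    (h : IsPartition s δ N τ) (n : Icc (0 : ℝ) T → ℕ) (F : Finset x.jumpTimes)
    (hF : ∀ r ∈ F, ∀ r' ∈ F, r ≠ r' → δ < |((r : Icc (0 : ℝ) T) : ℝ) - (r' : Icc (0 : ℝ) T)|) :
    discreteThin p s n N τ x.jumpPart
      ≤ ∏ r ∈ F, thinFactor p (tailWeight s n r) (x.jump r) := by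
  classical
  choose idx hidx hidx1 hidx2 using fun r : x.jumpTimes => h.exists_mem_Ioc (x.pos_of_jumpTimes r)
  have hinj : ∀ r ∈ F, ∀ r' ∈ F, idx r = idx r' → r = r' := by
    intro r hr r' hr' hrr
    by_contra hne
    have h1 := hF r hr r' hr' hne
    have h2 : ((τ (idx r) : Icc (0 : ℝ) T) : ℝ) < (r : Icc (0 : ℝ) T) := hidx1 r
    have h3 : ((r : Icc (0 : ℝ) T) : ℝ) ≤ τ (idx r + 1) := hidx2 r
    have h4 : ((τ (idx r') : Icc (0 : ℝ) T) : ℝ) < (r' : Icc (0 : ℝ) T) := hidx1 r'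
    have h5 : ((r' : Icc (0 : ℝ) T) : ℝ) ≤ τ (idx r' + 1) := hidx2 r'
    have h6 := h.mesh (idx r)
    rw [← hrr] at h4 h5
    exact absurd h1 (not_lt.2 (abs_le.2 ⟨by linarith, by linarith⟩))
  have hnn : ∀ i, 0 ≤ x.jumpPart (τ (i + 1)) - x.jumpPart (τ i) := fun i =>
    sub_nonneg.2 (x.jumpPart.mono (h.mono i.le_succ))
  have hsub : F.image idx ⊆ Finset.range N := Finset.image_subset_iff.2 fun r _ =>
    Finset.mem_range.2 (hidx r)
  refine (Finset.prod_le_prod_of_subset_of_le_one hsub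
    (fun i _ => thinFactor_nonneg p.2.1 p.2.2)
    fun i _ _ => thinFactor_le_one p.2.1 (tailWeight_nonneg _ _ _) (hnn i)).trans ?_
  rw [Finset.prod_image fun r hr r' hr' => hinj r hr r' hr']
  refine Finset.prod_le_prod (fun r _ => thinFactor_nonneg p.2.1 p.2.2) fun r _ => ?_
  rw [h.tailWeight_eq n (hidx1 r) (hidx2 r)]
  refine thinFactor_anti p.2.1 (tailWeight_nonneg _ _ _) ?_
  rw [jumpPart_apply, jumpPart_apply]
  exact x.le_jumpSum_sub (fun s => x.jump_nonneg s) x.summable_jumpTimes r (hidx1 r) (hidx2 r)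

/-- The Laplace transform of the thinned path is the limit of the products of thinning factors over
partitions of mesh tending to zero. -/
theorem tendsto_discreteThin (x : SubPath T) (p : unitInterval) {N : ℕ → ℕ}
    {τ : ℕ → ℕ → Icc (0 : ℝ) T} (h : ∀ k : ℕ, IsPartition s (1 / ((k : ℝ) + 1)) (N k) (τ k))
    (n : Icc (0 : ℝ) T → ℕ) :
    Tendsto (fun k => discreteThin p s n (N k) (τ k) x.jumpPart) atTop
      (𝓝 (∫ u, ∏ t ∈ s, Real.exp (-x.thin u t) ^ n t ∂x.marks p)) := by
  -- The lower bound holds for every partition. For the upper bound, a finite `F` already brings the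
  -- product below `b`, and a fine mesh separates its points.
  refine tendsto_order.2 ⟨fun a ha => Eventually.of_forall fun k =>
    ha.trans_le (x.prod_thinFactor_le_discreteThin p (h k) n), fun b hb => ?_⟩
  obtain ⟨F, hF⟩ := ((x.tendsto_prod_thinFactor p s n).eventually (gt_mem_nhds hb)).exists
  have hsep : ∀ᶠ k : ℕ in atTop, ∀ r ∈ F, ∀ r' ∈ F, r ≠ r' →
      1 / ((k : ℝ) + 1) < |((r : Icc (0 : ℝ) T) : ℝ) - (r' : Icc (0 : ℝ) T)| := by
    refine (Filter.eventually_all_finset F).2 fun r _ =>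
      (Filter.eventually_all_finset F).2 fun r' _ => ?_
    by_cases hr : r = r'
    · simp [hr]
    · have : 0 < |((r : Icc (0 : ℝ) T) : ℝ) - (r' : Icc (0 : ℝ) T)| :=
        abs_pos.2 (sub_ne_zero.2 fun h' => hr (Subtype.ext (Subtype.ext h')))
      filter_upwards [tendsto_one_div_add_atTop_nhds_zero_nat.eventually (gt_mem_nhds this)]
        with k hk _ using hk
  filter_upwards [hsep] with k hk
  exact (x.discreteThin_le_prod_thinFactor p (h k) n F hk).trans_lt hF

end Discretization

end SubPath

/-! ### Laplace transforms of Gamma processes -/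

/-- Exponential tilting: `e^{-wy}` times the density of rate `r` is a constant times the density of
rate `r + w`, which has total mass one. -/
lemma integral_exp_neg_mul_gammaMeasure {a r w : ℝ} (ha : 0 < a) (hr : 0 < r) (hw : 0 ≤ w) :
    ∫ y, Real.exp (-(w * y)) ∂gammaMeasure a r = (r / (r + w)) ^ a := by
  have hrw : 0 < r + w := by linarith
  have h1 : ∀ y, (gammaPDF a r y).toReal • Real.exp (-(w * y))
      = (r / (r + w)) ^ a * (gammaPDF a (r + w) y).toReal := by
    intro y
    rw [gammaPDF, gammaPDF, ENNReal.toReal_ofReal (gammaPDFReal_nonneg ha hr y),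
      ENNReal.toReal_ofReal (gammaPDFReal_nonneg ha hrw y), gammaPDFReal, gammaPDFReal,
      smul_eq_mul]
    split_ifs
    · have h2 : Real.exp (-((r + w) * y)) = Real.exp (-(r * y)) * Real.exp (-(w * y)) := by
        rw [← Real.exp_add]; congr 1; ring
      have h3 : (r + w) ^ a ≠ 0 := (Real.rpow_pos_of_pos hrw a).ne'
      rw [Real.div_rpow hr.le hrw.le, h2]
      field_simp
    · simp
  have hm : ∀ r, Measurable (gammaPDF a r) := fun r => (measurable_gammaPDFReal a r).ennreal_ofReal
  have hlt : ∀ r, ∀ᵐ y, gammaPDF a r y < ⊤ := fun r =>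
    Eventually.of_forall fun y => ENNReal.ofReal_lt_top
  rw [gammaMeasure, integral_withDensity_eq_integral_toReal_smul (hm r) (hlt r)]
  simp_rw [h1]
  rw [integral_const_mul, integral_toReal (hm _).aemeasurable (hlt _),
    lintegral_gammaPDF_eq_one ha hrw, ENNReal.toReal_one, mul_one]

namespace IsGammaProcessLaw

variable {T α β : ℝ} {P : Measure (SubPath T)}

lemma integral_exp_increment (hP : IsGammaProcessLaw T α β P) (hα : 0 < α) (hβ : 0 < β)
    {r t : Icc (0 : ℝ) T} (hrt : r ≤ t) {w : ℝ} (hw : 0 ≤ w) :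
    ∫ x, Real.exp (-(w * (x t - x r))) ∂P = (α / (α + w)) ^ (β * ((t : ℝ) - r)) := by
  have := hP.isProbabilityMeasure
  rcases eq_or_lt_of_le hrt with rfl | hlt
  · simp
  · have h := hP.gammaIncrements r t hlt
    have h1 : 0 < (t : ℝ) - r := sub_pos.2 hlt
    rw [← integral_exp_neg_mul_gammaMeasure (mul_pos hβ h1) hα hw, ← h.map_eq,
      integral_map h.aemeasurable (by fun_prop)]

lemma integral_prod_increments (hP : IsGammaProcessLaw T α β P) {τ : ℕ → Icc (0 : ℝ) T}
    (hτ : Monotone τ) {g : ℕ → ℝ → ℝ} (hg : ∀ i, Continuous (g i)) (N : ℕ) :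
    ∫ x, ∏ i ∈ Finset.range N, g i (x (τ (i + 1)) - x (τ i)) ∂P
      = ∏ i ∈ Finset.range N, ∫ x, g i (x (τ (i + 1)) - x (τ i)) ∂P := by
  have hm : ∀ i, Measurable fun x : SubPath T => x (τ (i + 1)) - x (τ i) := fun i =>
    (SubPath.measurable_apply _).sub (SubPath.measurable_apply _)
  have h1 := (hP.indepIncrements.nat hτ).precomp (Fin.val_injective (n := N))
  have h2 := h1.integral_fun_prod_comp (f := fun i : Fin N => g i) (fun i => (hm i).aemeasurable)
    fun i => (hg i).aestronglyMeasurable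
  rw [Finset.prod_range, ← h2]
  simp_rw [Finset.prod_range]

lemma integral_prod_exp_increments (hP : IsGammaProcessLaw T α β P) (hα : 0 < α) (hβ : 0 < β)
    {τ : ℕ → Icc (0 : ℝ) T} (hτ : Monotone τ) {w : ℕ → ℝ} (hw : ∀ i, 0 ≤ w i) (N : ℕ) :
    ∫ x, ∏ i ∈ Finset.range N, Real.exp (-(w i * (x (τ (i + 1)) - x (τ i)))) ∂P
      = ∏ i ∈ Finset.range N, (α / (α + w i)) ^ (β * ((τ (i + 1) : ℝ) - τ i)) := by
  rw [hP.integral_prod_increments hτ (g := fun i y => Real.exp (-(w i * y)))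
    (fun i => by fun_prop)]
  exact Finset.prod_congr rfl fun i _ =>
    hP.integral_exp_increment hα hβ (hτ i.le_succ) (hw i)

lemma integral_prod_exp (hP : IsGammaProcessLaw T α β P) (hα : 0 < α) (hβ : 0 < β)
    {s : Finset (Icc (0 : ℝ) T)} {δ : ℝ} {N : ℕ} {τ : ℕ → Icc (0 : ℝ) T}
    (h : IsPartition s δ N τ) (n : Icc (0 : ℝ) T → ℕ) :
    ∫ x, ∏ t ∈ s, Real.exp (-x t) ^ n t ∂P = ∏ i ∈ Finset.range N,
      (α / (α + tailWeight s n (τ (i + 1)))) ^ (β * ((τ (i + 1) : ℝ) - τ i)) := by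
  rw [← hP.integral_prod_exp_increments hα hβ h.mono
    (w := fun i => tailWeight s n (τ (i + 1))) (fun i => tailWeight_nonneg _ _ _)]
  exact integral_congr_ae (Eventually.of_forall fun x =>
    h.prod_exp_eq n x (x.eq_zero_of_isPartition h))

end IsGammaProcessLaw

/-! ### Gamma processes are pure jump processes -/

/-- For `u = y / ε`, the bound `e^{-u} ≤ 1 / (1 + u)` gives `1 - e^{-u} ≥ u / (1 + u) ≥ min u 1 /
2`. This replaces the cut-off by a function whose mean is known. -/
lemma min_le_two_mul_one_sub_exp {y ε : ℝ} (hy : 0 ≤ y) (hε : 0 < ε) :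
    min y ε ≤ 2 * ε * (1 - Real.exp (-(1 / ε * y))) := by
  have hu : 0 ≤ 1 / ε * y := by positivity
  obtain ⟨u, hu'⟩ : ∃ u, 1 / ε * y = u := ⟨_, rfl⟩
  have hy' : y = ε * u := by rw [← hu']; field_simp
  rw [hu'] at hu ⊢
  have h1 : Real.exp (-u) ≤ 1 / (1 + u) := by
    rw [Real.exp_neg, ← one_div]
    exact one_div_le_one_div_of_le (by linarith) (by linarith [Real.add_one_le_exp u])
  have h2 : min u 1 ≤ 2 * (1 - 1 / (1 + u)) := by
    have h3 : 1 - 1 / (1 + u) = u / (1 + u) := by field_simp; ring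
    rw [h3, ← mul_div_assoc, le_div_iff₀ (by linarith)]
    rcases le_total u 1 with h | h
    · rw [min_eq_left h]; nlinarith
    · rw [min_eq_right h]; nlinarith
  have h4 : min y ε = ε * min u 1 := by
    rw [hy', mul_min_of_nonneg _ _ hε.le, mul_one]
  rw [h4]
  nlinarith

lemma one_sub_rpow_le {y a : ℝ} (hy : 0 < y) : 1 - y ^ a ≤ a * Real.log y⁻¹ := by
  rw [Real.rpow_def_of_pos hy, Real.log_inv]
  linarith [Real.add_one_le_exp (Real.log y * a)]

namespace IsGammaProcessLaw

variable {T α β : ℝ} {P : Measure (SubPath T)}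

/-- The Laplace transform at `w = 1 / ε` and `one_sub_rpow_le` bound each cell by a multiple of its
length. The lengths add up to `T`, so the bound does not depend on the partition. -/
lemma lintegral_cutoffSum_le (hP : IsGammaProcessLaw T α β P) (hα : 0 < α) (hβ : 0 < β)
    {s : Finset (Icc (0 : ℝ) T)} {δ : ℝ} {N : ℕ} {τ : ℕ → Icc (0 : ℝ) T}
    (h : IsPartition s δ N τ) {ε : ℝ} (hε : 0 < ε) :
    ∫⁻ x, ENNReal.ofReal (SubPath.cutoffSum ε N τ (τ N) x) ∂P
      ≤ ENNReal.ofReal (2 * ε * (β * T * Real.log (α / (α + 1 / ε))⁻¹)) := by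
  have := hP.isProbabilityMeasure
  have hmono : ∀ (x : SubPath T) i, 0 ≤ x (τ (i + 1)) - x (τ i) := fun x i =>
    sub_nonneg.2 (x.mono (h.mono i.le_succ))
  have hinc : ∀ (x : SubPath T), SubPath.cutoffSum ε N τ (τ N) x
      ≤ ∑ i ∈ Finset.range N, 2 * ε * (1 - Real.exp (-(1 / ε * (x (τ (i + 1)) - x (τ i))))) := by
    intro x
    refine Finset.sum_le_sum fun i _ => ?_
    rw [inf_of_le_left (h.le_last _), inf_of_le_left (h.le_last _)]
    exact min_le_two_mul_one_sub_exp (hmono x i) hε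
  have hexp : ∀ i, Integrable
      (fun x : SubPath T => Real.exp (-(1 / ε * (x (τ (i + 1)) - x (τ i))))) P := by
    intro i
    refine Integrable.of_bound (C := 1) (((((SubPath.measurable_apply _).sub
      (SubPath.measurable_apply _)).const_mul _).neg.exp).aestronglyMeasurable)
      (Eventually.of_forall fun x => ?_)
    rw [Real.norm_of_nonneg (Real.exp_pos _).le]
    exact Real.exp_le_one_iff.2 (neg_nonpos.2 (mul_nonneg (by positivity) (hmono x i)))
  have hint : ∀ i, Integrable (fun x : SubPath T =>
      2 * ε * (1 - Real.exp (-(1 / ε * (x (τ (i + 1)) - x (τ i)))))) P := fun i =>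
    ((integrable_const _).sub (hexp i)).const_mul _
  calc ∫⁻ x, ENNReal.ofReal (SubPath.cutoffSum ε N τ (τ N) x) ∂P
      ≤ ∫⁻ x, ENNReal.ofReal (∑ i ∈ Finset.range N,
          2 * ε * (1 - Real.exp (-(1 / ε * (x (τ (i + 1)) - x (τ i)))))) ∂P :=
        lintegral_mono fun x => ENNReal.ofReal_le_ofReal (hinc x)
    _ = ENNReal.ofReal (∫ x, ∑ i ∈ Finset.range N,
          2 * ε * (1 - Real.exp (-(1 / ε * (x (τ (i + 1)) - x (τ i))))) ∂P) := by
        rw [ofReal_integral_eq_lintegral_ofReal (integrable_finsetSum _ fun i _ => hint i)]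
        refine Eventually.of_forall fun x => Finset.sum_nonneg fun i _ => ?_
        exact (le_min (hmono x i) hε.le).trans (min_le_two_mul_one_sub_exp (hmono x i) hε)
    _ ≤ _ := by
        refine ENNReal.ofReal_le_ofReal ?_
        have hsum : 2 * ε * (β * T * Real.log (α / (α + 1 / ε))⁻¹) = ∑ i ∈ Finset.range N,
            2 * ε * (β * ((τ (i + 1) : ℝ) - τ i) * Real.log (α / (α + 1 / ε))⁻¹) := by
          rw [← Finset.mul_sum, ← Finset.sum_mul, ← Finset.mul_sum, h.sum_sub]
        rw [integral_finsetSum _ fun i _ => hint i, hsum]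
        refine Finset.sum_le_sum fun i _ => ?_
        rw [integral_const_mul, integral_sub (integrable_const _) (hexp i), integral_const,
          hP.integral_exp_increment hα hβ (h.mono i.le_succ) (by positivity)]
        simp only [probReal_univ, smul_eq_mul, mul_one]
        exact mul_le_mul_of_nonneg_left (one_sub_rpow_le (by positivity)) (by positivity)

/-- A Gamma process is almost surely a pure jump process. -/
theorem ae_jumpPart_eq (hP : IsGammaProcessLaw T α β P) (hT : 0 ≤ T) (hα : 0 < α) (hβ : 0 < β) :
    ∀ᵐ x ∂P, x.jumpPart = x := by
  obtain ⟨N, τ, h⟩ := IsPartition.exists_seq hT (∅ : Finset (Icc (0 : ℝ) T))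
  let top : Icc (0 : ℝ) T := ⟨T, hT, le_rfl⟩
  have htop : ∀ k, τ k (N k) = top := fun k => Subtype.ext (h k).last
  -- Fatou's lemma along the partitions, for a fixed cut-off `ε = 1 / (m + 1)`.
  have hbound : ∀ m : ℕ, ∫⁻ x, ENNReal.ofReal (x.contPart top) ∂P
      ≤ ENNReal.ofReal (2 * (1 / ((m : ℝ) + 1))
        * (β * T * Real.log (α / (α + 1 / (1 / ((m : ℝ) + 1))))⁻¹)) := by
    intro m
    have hε : 0 < 1 / ((m : ℝ) + 1) := by positivity
    calc ∫⁻ x, ENNReal.ofReal (x.contPart top) ∂P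
        ≤ ∫⁻ x, liminf (fun k => ENNReal.ofReal
            (SubPath.cutoffSum (1 / ((m : ℝ) + 1)) (N k) (τ k) top x)) atTop ∂P := by
          refine lintegral_mono fun x => le_liminf_of_le (by isBoundedDefault) ?_
          filter_upwards [x.eventually_contPart_le_cutoffSum h hε top] with k hk
          exact ENNReal.ofReal_le_ofReal hk
      _ ≤ liminf (fun k => ∫⁻ x, ENNReal.ofReal
            (SubPath.cutoffSum (1 / ((m : ℝ) + 1)) (N k) (τ k) top x) ∂P) atTop :=
          lintegral_liminf_le fun k => (SubPath.measurable_cutoffSum _ _ _ _).ennreal_ofReal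
      _ ≤ _ := by
          refine liminf_le_of_frequently_le (Eventually.of_forall fun k => ?_).frequently
            (by isBoundedDefault)
          rw [← htop k]
          exact hP.lintegral_cutoffSum_le hα hβ (h k) hε
  have hlim : Tendsto (fun m : ℕ => ENNReal.ofReal (2 * (1 / ((m : ℝ) + 1))
        * (β * T * Real.log (α / (α + 1 / (1 / ((m : ℝ) + 1))))⁻¹))) atTop (𝓝 0) := by
    rw [← ENNReal.ofReal_zero]
    refine ENNReal.tendsto_ofReal ?_
    have h1 : Tendsto (fun ε : ℝ => 4 * β * T * √(ε ^ 2 + ε / α)) (𝓝 0) (𝓝 0) := by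
      have : Continuous fun ε : ℝ => 4 * β * T * √(ε ^ 2 + ε / α) := by fun_prop
      simpa using this.tendsto 0
    refine squeeze_zero (fun m => ?_) (fun m => ?_)
      (h1.comp tendsto_one_div_add_atTop_nhds_zero_nat)
    · have : 0 ≤ Real.log (α / (α + 1 / (1 / ((m : ℝ) + 1))))⁻¹ := by
        refine Real.log_nonneg ?_
        rw [inv_div, one_le_div hα]
        linarith [show 0 ≤ 1 / (1 / ((m : ℝ) + 1)) by positivity]
      positivity
    · have hε : 0 < 1 / ((m : ℝ) + 1) := by positivity
      simp only [Function.comp]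
      obtain ⟨ε, hε'⟩ : ∃ ε, 1 / ((m : ℝ) + 1) = ε := ⟨_, rfl⟩
      rw [hε'] at hε ⊢
      -- Writing the argument as a square `z ^ 2` and using `log z ≤ z` gives a bound of order `√ε`,
      -- enough to beat the logarithmic growth.
      have h2 : (α / (α + 1 / ε))⁻¹ = (√(ε ^ 2 + ε / α) / ε) ^ 2 := by
        rw [div_pow, Real.sq_sqrt (by positivity)]
        field_simp
      have h3 : Real.log (√(ε ^ 2 + ε / α) / ε) ≤ √(ε ^ 2 + ε / α) / ε :=
        Real.log_le_self (by positivity)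
      rw [h2, Real.log_pow]
      push_cast
      calc 2 * ε * (β * T * (2 * Real.log (√(ε ^ 2 + ε / α) / ε)))
          ≤ 2 * ε * (β * T * (2 * (√(ε ^ 2 + ε / α) / ε))) := by gcongr
        _ = 4 * β * T * √(ε ^ 2 + ε / α) := by field_simp; ring
  have hzero : ∫⁻ x, ENNReal.ofReal (x.contPart top) ∂P = 0 :=
    le_antisymm (ge_of_tendsto' hlim hbound) zero_le
  rw [lintegral_eq_zero_iff (SubPath.measurable_contPart top).ennreal_ofReal] at hzero
  filter_upwards [hzero] with x hx
  -- The continuous part is nonnegative and monotone, so vanishing at the final time makes it vanish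
  -- throughout.
  have hx' : x.contPart top ≤ 0 := ENNReal.ofReal_eq_zero.1 hx
  refine SubPath.ext fun t => ?_
  have h1 := x.contPart_mono (show t ≤ top from t.2.2)
  have h2 := x.contPart_nonneg t
  have h3 : x.contPart t = x t - x.jumpPart t := rfl
  linarith

end IsGammaProcessLaw

/-! ### Joint Laplace transform of a Gamma process and its thinning -/

lemma abs_prod_sub_prod_le {ι : Type*} {f g : ι → ℝ} (F : Finset ι)
    (hf0 : ∀ i, 0 ≤ f i) (hf1 : ∀ i, f i ≤ 1) (hg0 : ∀ i, 0 ≤ g i) (hg1 : ∀ i, g i ≤ 1) :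
    |∏ i ∈ F, f i - ∏ i ∈ F, g i| ≤ ∑ i ∈ F, |f i - g i| := by
  classical
  induction F using Finset.induction_on with
  | empty => simp
  | insert a F ha ih =>
    rw [Finset.prod_insert ha, Finset.prod_insert ha, Finset.sum_insert ha]
    have h1 : f a * ∏ i ∈ F, f i - g a * ∏ i ∈ F, g i
        = (f a - g a) * ∏ i ∈ F, f i + g a * (∏ i ∈ F, f i - ∏ i ∈ F, g i) := by ring
    have h2 : |∏ i ∈ F, f i| ≤ 1 := by
      rw [abs_of_nonneg (Finset.prod_nonneg fun i _ => hf0 i)]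
      exact Finset.prod_le_one (fun i _ => hf0 i) fun i _ => hf1 i
    rw [h1]
    refine (abs_add_le _ _).trans (add_le_add ?_ ?_)
    · rw [abs_mul]
      exact mul_le_of_le_one_right (abs_nonneg _) h2
    · rw [abs_mul, abs_of_nonneg (hg0 a)]
      exact (mul_le_of_le_one_left (abs_nonneg _) (hg1 a)).trans ih

/-- From `e^{-x} ≤ 1 / (1 + x)` and `(1 + x) (1 - x + x²) = 1 + x³ ≥ 1`. -/
lemma exp_neg_le_one_sub_add_sq {x : ℝ} (hx : 0 ≤ x) : Real.exp (-x) ≤ 1 - x + x ^ 2 := by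
  have h1 : Real.exp (-x) ≤ 1 / (1 + x) := by
    rw [Real.exp_neg, ← one_div]
    exact one_div_le_one_div_of_le (by linarith) (by linarith [Real.add_one_le_exp x])
  refine h1.trans ((div_le_iff₀ (by linarith)).2 ?_)
  nlinarith [pow_nonneg hx 3]

/-- The weighted arithmetic and geometric means of `e⁻ˣ` and `e⁻ʸ` agree to second order. -/
lemma abs_mean_exp_sub_exp_mean_le {p x y X : ℝ} (h0 : 0 ≤ p) (h1 : p ≤ 1) (hx : 0 ≤ x)
    (hy : 0 ≤ y) (hxX : x ≤ X) (hyX : y ≤ X) :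
    |(1 - p) * Real.exp (-x) + p * Real.exp (-y) - Real.exp (-((1 - p) * x + p * y))| ≤ X ^ 2 := by
  have h2 : 0 ≤ 1 - p := sub_nonneg.2 h1
  have hz : 0 ≤ (1 - p) * x + p * y := by positivity
  have hzX : (1 - p) * x + p * y ≤ X := by nlinarith
  have hxx : x ^ 2 ≤ X ^ 2 := by gcongr
  have hyy : y ^ 2 ≤ X ^ 2 := by gcongr
  have hzz : ((1 - p) * x + p * y) ^ 2 ≤ X ^ 2 := by gcongr
  have ex := exp_neg_le_one_sub_add_sq hx
  have ey := exp_neg_le_one_sub_add_sq hy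
  have ez := exp_neg_le_one_sub_add_sq hz
  have fx := Real.add_one_le_exp (-x)
  have fy := Real.add_one_le_exp (-y)
  have fz := Real.add_one_le_exp (-((1 - p) * x + p * y))
  have := mul_le_mul_of_nonneg_left ex h2
  have := mul_le_mul_of_nonneg_left ey h0
  have := mul_le_mul_of_nonneg_left fx h2
  have := mul_le_mul_of_nonneg_left fy h0
  have := mul_le_mul_of_nonneg_left hxx h2
  have := mul_le_mul_of_nonneg_left hyy h0
  exact abs_le.2 ⟨by linarith, by linarith⟩

lemma rpow_eq_exp_neg {α w a : ℝ} (hα : 0 < α) (hw : 0 ≤ w) :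
    (α / (α + w)) ^ a = Real.exp (-(a * Real.log ((α + w) / α))) := by
  rw [Real.rpow_def_of_pos (by positivity), ← inv_div α, Real.log_inv]
  congr 1; ring

namespace IsGammaProcessLaw

variable {T α β : ℝ} {P : Measure (SubPath T)}

/-- On each cell the integrand is a mixture of two exponentials of the same increment, so
independence and the Gamma Laplace transform evaluate it exactly. -/
lemma integral_prod_exp_mul_discreteThin (hP : IsGammaProcessLaw T α β P) (hα : 0 < α) (hβ : 0 < β)
    (p : ℝ) {s s' : Finset (Icc (0 : ℝ) T)} {δ : ℝ} {N : ℕ} {τ : ℕ → Icc (0 : ℝ) T}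
    (h : IsPartition s δ N τ) (n n' : Icc (0 : ℝ) T → ℕ) :
    ∫ x, (∏ t ∈ s, Real.exp (-x t) ^ n t) * SubPath.discreteThin p s' n' N τ x ∂P
      = ∏ i ∈ Finset.range N,
        ((1 - p) * (α / (α + tailWeight s n (τ (i + 1)))) ^ (β * ((τ (i + 1) : ℝ) - τ i))
        + p * (α / (α + (tailWeight s n (τ (i + 1)) + tailWeight s' n' (τ (i + 1)))))
          ^ (β * ((τ (i + 1) : ℝ) - τ i))) := by
  have := hP.isProbabilityMeasure
  have h1 : ∀ x : SubPath T,
      (∏ t ∈ s, Real.exp (-x t) ^ n t) * SubPath.discreteThin p s' n' N τ x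
      = ∏ i ∈ Finset.range N,
        ((1 - p) * Real.exp (-(tailWeight s n (τ (i + 1)) * (x (τ (i + 1)) - x (τ i))))
        + p * Real.exp (-((tailWeight s n (τ (i + 1)) + tailWeight s' n' (τ (i + 1)))
          * (x (τ (i + 1)) - x (τ i))))) := by
    intro x
    rw [h.prod_exp_eq n x (x.eq_zero_of_isPartition h), SubPath.discreteThin,
      ← Finset.prod_mul_distrib]
    refine Finset.prod_congr rfl fun i _ => ?_
    rw [thinFactor, add_mul, neg_add, Real.exp_add]
    ring
  have hint : ∀ (w : ℝ), 0 ≤ w → ∀ i, Integrable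
      (fun x : SubPath T => Real.exp (-(w * (x (τ (i + 1)) - x (τ i))))) P := by
    intro w hw i
    refine Integrable.of_bound (C := 1) (((((SubPath.measurable_apply _).sub
      (SubPath.measurable_apply _)).const_mul _).neg.exp).aestronglyMeasurable)
      (Eventually.of_forall fun x => ?_)
    rw [Real.norm_of_nonneg (Real.exp_pos _).le]
    exact Real.exp_le_one_iff.2 (neg_nonpos.2
      (mul_nonneg hw (sub_nonneg.2 (x.mono (h.mono i.le_succ)))))
  simp_rw [h1]
  rw [hP.integral_prod_increments h.mono (g := fun i y =>
    (1 - p) * Real.exp (-(tailWeight s n (τ (i + 1)) * y))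
      + p * Real.exp (-((tailWeight s n (τ (i + 1)) + tailWeight s' n' (τ (i + 1))) * y)))
    fun i => by fun_prop]
  refine Finset.prod_congr rfl fun i _ => ?_
  have hw := tailWeight_nonneg s n (τ (i + 1))
  have hw' := add_nonneg hw (tailWeight_nonneg s' n' (τ (i + 1)))
  rw [integral_add ((hint _ hw i).const_mul _) ((hint _ hw' i).const_mul _), integral_const_mul,
    integral_const_mul, hP.integral_exp_increment hα hβ (h.mono i.le_succ) hw,
    hP.integral_exp_increment hα hβ (h.mono i.le_succ) hw']

/-- The joint Laplace transform of a Gamma process and its thinning. -/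
theorem integral_prod_exp_mul_integral_thin {β' : ℝ} {P' P'' : Measure (SubPath T)} (hT : 0 ≤ T)
    (hα : 0 < α) (hβ : 0 < β) (hβ' : 0 < β') (hlt : β' < β) (hP : IsGammaProcessLaw T α β P)
    (hP' : IsGammaProcessLaw T α β' P') (hP'' : IsGammaProcessLaw T α (β - β') P'')
    (p : unitInterval) (hp : (p : ℝ) = β' / β) (s s' : Finset (Icc (0 : ℝ) T))
    (n n' : Icc (0 : ℝ) T → ℕ) :
    ∫ x, (∏ t ∈ s, Real.exp (-x t) ^ n t)
        * ∫ u, ∏ t ∈ s', Real.exp (-x.thin u t) ^ n' t ∂x.marks p ∂P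
      = (∫ y, (∏ t ∈ s, Real.exp (-y t) ^ n t) * ∏ t ∈ s', Real.exp (-y t) ^ n' t ∂P')
        * ∫ z, ∏ t ∈ s, Real.exp (-z t) ^ n t ∂P'' := by
  classical
  have := hP.isProbabilityMeasure
  have h0 := p.2.1
  have h1 := p.2.2
  have hβp : β' = p * β := by rw [hp]; field_simp
  obtain ⟨N, τ, h⟩ := IsPartition.exists_seq hT (s ∪ s')
  have hs : ∀ k : ℕ, IsPartition s (1 / ((k : ℝ) + 1)) (N k) (τ k) := fun k =>
    (h k).subset Finset.subset_union_left
  have hs' : ∀ k : ℕ, IsPartition s' (1 / ((k : ℝ) + 1)) (N k) (τ k) := fun k =>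
    (h k).subset Finset.subset_union_right
  -- the two rates of decay on the interval `(τ i, τ (i + 1)]`
  let u : Icc (0 : ℝ) T → ℝ := fun r => Real.log ((α + tailWeight s n r) / α)
  let v : Icc (0 : ℝ) T → ℝ := fun r =>
    Real.log ((α + (tailWeight s n r + tailWeight s' n' r)) / α)
  have hw := tailWeight_nonneg s n
  have hw' := tailWeight_nonneg s' n'
  have hu0 : ∀ r, 0 ≤ u r := fun r => Real.log_nonneg ((one_le_div hα).2 (by linarith [hw r]))
  have hv0 : ∀ r, 0 ≤ v r := fun r =>
    Real.log_nonneg ((one_le_div hα).2 (by linarith [hw r, hw' r]))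
  obtain ⟨K, hK⟩ : ∃ K : ℝ, K = Real.log
      ((α + (∑ t ∈ s, (n t : ℝ) + ∑ t ∈ s', (n' t : ℝ))) / α) := ⟨_, rfl⟩
  have hvK : ∀ r, v r ≤ K := fun r => by
    have := tailWeight_le s n r
    have := tailWeight_le s' n' r
    rw [hK]
    have := hw r
    have := hw' r
    refine Real.log_le_log (by positivity) ?_
    gcongr
  have huv : ∀ r, u r ≤ v r := fun r => by
    have := hw r
    have := hw' r
    refine Real.log_le_log (by positivity) ?_
    gcongr
    linarith
  -- The factors use increments of `x` itself; this is legitimate because `x.jumpPart = x` almost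
  -- surely.
  have hlim : Tendsto (fun k => ∫ x, (∏ t ∈ s, Real.exp (-x t) ^ n t)
      * SubPath.discreteThin p s' n' (N k) (τ k) x ∂P) atTop
      (𝓝 (∫ x, (∏ t ∈ s, Real.exp (-x t) ^ n t)
        * ∫ u, ∏ t ∈ s', Real.exp (-x.thin u t) ^ n' t ∂x.marks p ∂P)) := by
    refine tendsto_integral_of_dominated_convergence (fun _ => 1) (fun k => ?_)
      (integrable_const _) (fun k => Eventually.of_forall fun x => ?_) ?_
    · refine ((Finset.measurable_prod _ fun t _ =>
        (SubPath.measurable_apply t).neg.exp.pow_const _).mul ?_).aestronglyMeasurable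
      exact Finset.measurable_prod _ fun i _ => continuous_thinFactor.measurable.comp
        (measurable_const.prodMk (measurable_const.prodMk
          ((SubPath.measurable_apply _).sub (SubPath.measurable_apply _))))
    · have h2 : 0 ≤ ∏ t ∈ s, Real.exp (-x t) ^ n t := Finset.prod_nonneg fun t _ => by positivity
      have h3 : ∏ t ∈ s, Real.exp (-x t) ^ n t ≤ 1 :=
        Finset.prod_le_one (fun t _ => by positivity) fun t _ => pow_le_one₀ (Real.exp_pos _).le
          (Real.exp_le_one_iff.2 (neg_nonpos.2 (x.apply_nonneg t)))
      have h4 : 0 ≤ SubPath.discreteThin p s' n' (N k) (τ k) x :=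
        Finset.prod_nonneg fun i _ => thinFactor_nonneg h0 h1
      have h5 : SubPath.discreteThin p s' n' (N k) (τ k) x ≤ 1 :=
        Finset.prod_le_one (fun i _ => thinFactor_nonneg h0 h1) fun i _ =>
          thinFactor_le_one h0 (tailWeight_nonneg _ _ _)
            (sub_nonneg.2 (x.mono ((h k).mono i.le_succ)))
      rw [Real.norm_of_nonneg (mul_nonneg h2 h4)]
      exact mul_le_one₀ h3 h4 h5
    · filter_upwards [hP.ae_jumpPart_eq hT hα hβ] with x hx
      have := x.tendsto_discreteThin p hs' n'
      rw [hx] at this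
      exact this.const_mul _
  -- This side is exactly a product over every partition. The shapes `β' = p β` and `β - β' = (1 -
  -- p) β` turn each factor into the geometric mean.
  have hrhs : ∀ k, (∫ y, (∏ t ∈ s, Real.exp (-y t) ^ n t) * ∏ t ∈ s', Real.exp (-y t) ^ n' t ∂P')
        * ∫ z, ∏ t ∈ s, Real.exp (-z t) ^ n t ∂P''
      = ∏ i ∈ Finset.range (N k), Real.exp (-((1 - p) *
          (β * ((τ k (i + 1) : ℝ) - τ k i) * u (τ k (i + 1)))
        + p * (β * ((τ k (i + 1) : ℝ) - τ k i) * v (τ k (i + 1))))) := by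
    intro k
    have h2 : ∀ y : SubPath T,
        (∏ t ∈ s, Real.exp (-y t) ^ n t) * ∏ t ∈ s', Real.exp (-y t) ^ n' t
        = ∏ i ∈ Finset.range (N k), Real.exp (-((tailWeight s n (τ k (i + 1))
          + tailWeight s' n' (τ k (i + 1))) * (y (τ k (i + 1)) - y (τ k i)))) := by
      intro y
      rw [(hs k).prod_exp_eq n y (y.eq_zero_of_isPartition (h k)),
        (hs' k).prod_exp_eq n' y (y.eq_zero_of_isPartition (h k)), ← Finset.prod_mul_distrib]
      exact Finset.prod_congr rfl fun i _ => by rw [← Real.exp_add]; congr 1; ring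
    simp_rw [h2]
    rw [hP'.integral_prod_exp_increments hα hβ' (h k).mono
      (w := fun i => tailWeight s n (τ k (i + 1)) + tailWeight s' n' (τ k (i + 1)))
      (fun i => add_nonneg (hw _) (hw' _)), hP''.integral_prod_exp hα (sub_pos.2 hlt) (hs k) n,
      ← Finset.prod_mul_distrib]
    refine Finset.prod_congr rfl fun i _ => ?_
    rw [rpow_eq_exp_neg hα (hw _), rpow_eq_exp_neg hα (add_nonneg (hw _) (hw' _)),
      ← Real.exp_add, hβp]
    congr 1
    simp only [u, v]
    ring
  refine tendsto_nhds_unique hlim ?_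
  -- Cell errors are at most `(β d K)²`, where `d` is the cell length. One factor `d` sums to `T`,
  -- the other is at most the mesh.
  have hX : Tendsto (fun k : ℕ => (β * K) ^ 2 * T * (1 / ((k : ℝ) + 1))) atTop (𝓝 0) := by
    simpa using tendsto_one_div_add_atTop_nhds_zero_nat.const_mul ((β * K) ^ 2 * T)
  rw [tendsto_iff_dist_tendsto_zero]
  refine squeeze_zero (fun _ => dist_nonneg) (fun k => ?_) hX
  rw [Real.dist_eq, hrhs k, hP.integral_prod_exp_mul_discreteThin hα hβ p (hs k)]
  have hδ : ∀ i, 0 ≤ (τ k (i + 1) : ℝ) - τ k i := fun i =>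
    sub_nonneg.2 (Subtype.coe_le_coe.2 ((h k).mono i.le_succ))
  have hx0 : ∀ i, 0 ≤ β * ((τ k (i + 1) : ℝ) - τ k i) * u (τ k (i + 1)) := fun i =>
    mul_nonneg (mul_nonneg hβ.le (hδ i)) (hu0 _)
  have hy0 : ∀ i, 0 ≤ β * ((τ k (i + 1) : ℝ) - τ k i) * v (τ k (i + 1)) := fun i =>
    mul_nonneg (mul_nonneg hβ.le (hδ i)) (hv0 _)
  have hp1 : 0 ≤ 1 - (p : ℝ) := sub_nonneg.2 h1
  have he : ∀ {y : ℝ}, 0 ≤ y → Real.exp (-y) ≤ 1 := fun hy =>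
    Real.exp_le_one_iff.2 (neg_nonpos.2 hy)
  simp_rw [rpow_eq_exp_neg hα (hw _), rpow_eq_exp_neg hα (add_nonneg (hw _) (hw' _))]
  refine (abs_prod_sub_prod_le _ (fun i => by positivity) (fun i => ?_)
    (fun i => (Real.exp_pos _).le) (fun i => he (add_nonneg (mul_nonneg hp1 (hx0 i))
      (mul_nonneg h0 (hy0 i))))).trans ?_
  · have e1 := mul_le_mul_of_nonneg_left (he (hx0 i)) hp1
    have e2 := mul_le_mul_of_nonneg_left (he (hy0 i)) h0
    simp only [u, v] at e1 e2
    linarith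
  · have hsum : (β * K) ^ 2 * T * (1 / ((k : ℝ) + 1)) = ∑ i ∈ Finset.range (N k),
        (β * K) ^ 2 * ((τ k (i + 1) : ℝ) - τ k i) * (1 / ((k : ℝ) + 1)) := by
      rw [← Finset.sum_mul, ← Finset.mul_sum, (h k).sum_sub]
    rw [hsum]
    refine Finset.sum_le_sum fun i _ => ?_
    have hyX : β * ((τ k (i + 1) : ℝ) - τ k i) * v (τ k (i + 1))
        ≤ β * ((τ k (i + 1) : ℝ) - τ k i) * K :=
      mul_le_mul_of_nonneg_left (hvK _) (mul_nonneg hβ.le (hδ i))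
    have hxX : β * ((τ k (i + 1) : ℝ) - τ k i) * u (τ k (i + 1))
        ≤ β * ((τ k (i + 1) : ℝ) - τ k i) * v (τ k (i + 1)) :=
      mul_le_mul_of_nonneg_left (huv _) (mul_nonneg hβ.le (hδ i))
    refine (abs_mean_exp_sub_exp_mean_le h0 h1 (hx0 i) (hy0 i) (hxX.trans hyX) hyX).trans ?_
    calc (β * ((τ k (i + 1) : ℝ) - τ k i) * K) ^ 2
        = (β * K) ^ 2 * ((τ k (i + 1) : ℝ) - τ k i) * ((τ k (i + 1) : ℝ) - τ k i) := by ring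
      _ ≤ _ := mul_le_mul_of_nonneg_left ((h k).mesh i)
          (mul_nonneg (sq_nonneg _) (hδ i))

end IsGammaProcessLaw

/-! ### Laplace transforms determine laws of paths -/

namespace SubPath

variable {T : ℝ}

/-- The coordinate `x ↦ e^{-x t}` with values in the unit interval. -/
noncomputable def expCoord (t : Icc (0 : ℝ) T) (x : SubPath T) : unitInterval :=
  ⟨Real.exp (-x t), (Real.exp_pos _).le, Real.exp_le_one_iff.2 (neg_nonpos.2 (x.apply_nonneg t))⟩

lemma measurable_expCoord (t : Icc (0 : ℝ) T) : Measurable (expCoord t : SubPath T → _) :=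
  (measurable_apply t).neg.exp.subtype_mk

/-- Each coordinate is recovered as `-log` of its exponential, so nothing is lost by passing to `[0,
1]`-valued functions. -/
lemma measurableSpace_eq_iSup_comap_expCoord :
    (inferInstance : MeasurableSpace (SubPath T))
      = ⨆ t : Icc (0 : ℝ) T, MeasurableSpace.comap (expCoord t) inferInstance := by
  refine le_antisymm ?_ (iSup_le fun t => (measurable_expCoord t).comap_le)
  change MeasurableSpace.comap SubPath.toFun MeasurableSpace.pi ≤ _
  rw [MeasurableSpace.pi, MeasurableSpace.comap_iSup]
  refine iSup_mono fun t => ?_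
  rw [MeasurableSpace.comap_comp]
  have h : (fun b : Icc (0 : ℝ) T → ℝ => b t) ∘ SubPath.toFun
      = (fun y : unitInterval => -Real.log y) ∘ expCoord t := by
    ext x; simp [expCoord]
  rw [h, ← MeasurableSpace.comap_comp]
  exact MeasurableSpace.comap_mono (Measurable.comap_le (by fun_prop))

lemma measurableSpace_prod_eq_iSup_comap :
    (inferInstance : MeasurableSpace (SubPath T × SubPath T))
      = ⨆ i : Icc (0 : ℝ) T ⊕ Icc (0 : ℝ) T, MeasurableSpace.comap
        (Sum.elim (fun t (z : SubPath T × SubPath T) => expCoord t z.1)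
          (fun t z => expCoord t z.2) i) inferInstance := by
  rw [iSup_sum]
  change MeasurableSpace.comap Prod.fst inferInstance ⊔ MeasurableSpace.comap Prod.snd inferInstance
    = _
  rw [measurableSpace_eq_iSup_comap_expCoord, MeasurableSpace.comap_iSup,
    MeasurableSpace.comap_iSup]
  simp_rw [MeasurableSpace.comap_comp]
  rfl

lemma measurable_prod_exp (s : Finset (Icc (0 : ℝ) T)) (n : Icc (0 : ℝ) T → ℕ) :
    Measurable fun x : SubPath T => ∏ t ∈ s, Real.exp (-x t) ^ n t :=
  Finset.measurable_prod _ fun t _ => (measurable_apply t).neg.exp.pow_const _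

lemma prod_exp_nonneg (x : SubPath T) (s : Finset (Icc (0 : ℝ) T)) (n : Icc (0 : ℝ) T → ℕ) :
    0 ≤ ∏ t ∈ s, Real.exp (-x t) ^ n t :=
  Finset.prod_nonneg fun t _ => by positivity

lemma prod_exp_le_one (x : SubPath T) (s : Finset (Icc (0 : ℝ) T)) (n : Icc (0 : ℝ) T → ℕ) :
    ∏ t ∈ s, Real.exp (-x t) ^ n t ≤ 1 :=
  Finset.prod_le_one (fun t _ => by positivity) fun t _ => pow_le_one₀ (Real.exp_pos _).le
    (Real.exp_le_one_iff.2 (neg_nonpos.2 (x.apply_nonneg t)))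

lemma prod_exp_add (x y : SubPath T) (s : Finset (Icc (0 : ℝ) T)) (n : Icc (0 : ℝ) T → ℕ) :
    ∏ t ∈ s, Real.exp (-(x + y) t) ^ n t
      = (∏ t ∈ s, Real.exp (-x t) ^ n t) * ∏ t ∈ s, Real.exp (-y t) ^ n t := by
  rw [← Finset.prod_mul_distrib]
  exact Finset.prod_congr rfl fun t _ => by rw [add_apply, neg_add, Real.exp_add, mul_pow]

lemma integrable_prod_exp_mul_prod_exp (ν : Measure (SubPath T × SubPath T)) [IsFiniteMeasure ν]
    (s s' : Finset (Icc (0 : ℝ) T)) (n n' : Icc (0 : ℝ) T → ℕ) :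
    Integrable (fun z => (∏ t ∈ s, Real.exp (-z.1 t) ^ n t)
      * ∏ t ∈ s', Real.exp (-z.2 t) ^ n' t) ν := by
  refine Integrable.of_bound (C := 1) ((((measurable_prod_exp s n).comp measurable_fst).mul
    ((measurable_prod_exp s' n').comp measurable_snd)).aestronglyMeasurable)
    (Eventually.of_forall fun z => ?_)
  rw [Real.norm_of_nonneg (mul_nonneg (z.1.prod_exp_nonneg s n) (z.2.prod_exp_nonneg s' n'))]
  exact mul_le_one₀ (z.1.prod_exp_le_one s n) (z.2.prod_exp_nonneg s' n')
    (z.2.prod_exp_le_one s' n')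

lemma measurable_add_left (x : SubPath T) : Measurable fun y : SubPath T => x + y :=
  measurable_of_apply fun t => (measurable_apply t).const_add (x t)

/-- Laws on pairs of paths are determined by their joint Laplace transforms. -/
lemma ext_of_integral_prod_exp {μ ν : Measure (SubPath T × SubPath T)} [IsProbabilityMeasure μ]
    [IsProbabilityMeasure ν]
    (h : ∀ (s s' : Finset (Icc (0 : ℝ) T)) (n n' : Icc (0 : ℝ) T → ℕ),
      ∫ z, (∏ t ∈ s, Real.exp (-z.1 t) ^ n t) * ∏ t ∈ s', Real.exp (-z.2 t) ^ n' t ∂μ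
        = ∫ z, (∏ t ∈ s, Real.exp (-z.1 t) ^ n t) * ∏ t ∈ s', Real.exp (-z.2 t) ^ n' t ∂ν) :
    μ = ν := by
  refine ext_of_moments measurableSpace_prod_eq_iSup_comap fun s n => ?_
  have h1 : ∀ z : SubPath T × SubPath T, ∏ i ∈ s, ((Sum.elim
      (fun t (z : SubPath T × SubPath T) => expCoord t z.1) (fun t z => expCoord t z.2) i z
        : unitInterval) : ℝ) ^ n i
      = (∏ t ∈ s.toLeft, Real.exp (-z.1 t) ^ n (Sum.inl t))
        * ∏ t ∈ s.toRight, Real.exp (-z.2 t) ^ n (Sum.inr t) := by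
    intro z
    conv_lhs => rw [← Finset.toLeft_disjSum_toRight (u := s)]
    rw [Finset.prod_disjSum]
    rfl
  simp_rw [h1]
  exact h _ _ _ _

end SubPath

/-! ### Moments of the proposal -/

section Proposal

variable {T : ℝ} {P : Ioi (0 : ℝ) → Measure (SubPath T)} {β β' : Ioi (0 : ℝ)}

/-- The difference of two shape parameters. -/
def shapeSub (β β' : Ioi (0 : ℝ)) (h : β' < β) : Ioi (0 : ℝ) :=
  ⟨(β : ℝ) - β', mem_Ioi.2 (sub_pos.2 (Subtype.coe_lt_coe.2 h))⟩

lemma gammaProposal_of_lt (h : β < β') (x : SubPath T) :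
    gammaProposal P β β' x = (P (shapeSub β' β h)).map fun x' => x + x' := dif_pos h

lemma gammaProposal_of_gt (h : β' < β) (x : SubPath T) :
    gammaProposal P β β' x = (x.marks (thinProb β β' h.le)).map x.thin := by
  rw [gammaProposal, dif_neg h.not_gt, dif_pos h]
  rfl

lemma gammaProposal_self (β : Ioi (0 : ℝ)) (x : SubPath T) :
    gammaProposal P β β x = Measure.dirac x := by
  rw [gammaProposal, dif_neg (lt_irrefl _), dif_neg (lt_irrefl _)]

lemma isProbabilityMeasure_gammaProposal (hP : ∀ b, IsProbabilityMeasure (P b))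
    (β β' : Ioi (0 : ℝ)) (x : SubPath T) : IsProbabilityMeasure (gammaProposal P β β' x) := by
  rcases lt_trichotomy β β' with h | rfl | h
  · rw [gammaProposal_of_lt h]
    exact Measure.isProbabilityMeasure_map x.measurable_add_left.aemeasurable
  · rw [gammaProposal_self]; infer_instance
  · rw [gammaProposal_of_gt h]
    exact Measure.isProbabilityMeasure_map x.measurable_thin.aemeasurable

lemma integral_gammaProposal_of_lt (h : β < β') (x : SubPath T) (s : Finset (Icc (0 : ℝ) T))
    (n : Icc (0 : ℝ) T → ℕ) :
    ∫ y, ∏ t ∈ s, Real.exp (-y t) ^ n t ∂gammaProposal P β β' x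
      = (∏ t ∈ s, Real.exp (-x t) ^ n t)
        * ∫ z, ∏ t ∈ s, Real.exp (-z t) ^ n t ∂P (shapeSub β' β h) := by
  rw [gammaProposal_of_lt h, integral_map x.measurable_add_left.aemeasurable
    (SubPath.measurable_prod_exp s n).aestronglyMeasurable]
  simp_rw [SubPath.prod_exp_add]
  rw [integral_const_mul]

lemma integral_gammaProposal_of_gt (h : β' < β) (x : SubPath T) (s : Finset (Icc (0 : ℝ) T))
    (n : Icc (0 : ℝ) T → ℕ) :
    ∫ y, ∏ t ∈ s, Real.exp (-y t) ^ n t ∂gammaProposal P β β' x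
      = ∫ u, ∏ t ∈ s, Real.exp (-x.thin u t) ^ n t ∂x.marks (thinProb β β' h.le) := by
  rw [gammaProposal_of_gt h, integral_map x.measurable_thin.aemeasurable
    (SubPath.measurable_prod_exp s n).aestronglyMeasurable]

lemma integral_gammaProposal_self (β : Ioi (0 : ℝ)) (x : SubPath T) (s : Finset (Icc (0 : ℝ) T))
    (n : Icc (0 : ℝ) T → ℕ) :
    ∫ y, ∏ t ∈ s, Real.exp (-y t) ^ n t ∂gammaProposal P β β x
      = ∏ t ∈ s, Real.exp (-x t) ^ n t := by
  rw [gammaProposal_self, integral_dirac' _ _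
    (SubPath.measurable_prod_exp s n).stronglyMeasurable]

end Proposal

/-! ### Measurability of the kernels and balance -/

section Kernels

variable {T α : ℝ} {P : Ioi (0 : ℝ) → Measure (SubPath T)}

/-- Each moment is a finite product of powers whose exponents are linear in `β`. -/
theorem measurable_gammaLaw (hT : 0 ≤ T) (hα : 0 < α)
    (hP : ∀ β : Ioi (0 : ℝ), IsGammaProcessLaw T α β (P β)) : Measurable P := by
  have := fun b => (hP b).isProbabilityMeasure
  refine measurable_of_moments SubPath.measurableSpace_eq_iSup_comap_expCoord fun s n => ?_
  obtain ⟨N, τ, h⟩ := IsPartition.exists_of_finset (δ := 1) hT s one_pos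
  have h1 : ∀ β : Ioi (0 : ℝ), ∫ x, ∏ t ∈ s, (SubPath.expCoord t x : ℝ) ^ n t ∂P β
      = ∏ i ∈ Finset.range N,
        (α / (α + tailWeight s n (τ (i + 1)))) ^ ((β : ℝ) * ((τ (i + 1) : ℝ) - τ i)) :=
    fun β => (hP β).integral_prod_exp hα β.2 h n
  simp_rw [h1]
  fun_prop

theorem measurable_gammaProposal (hT : 0 ≤ T) (hα : 0 < α)
    (hP : ∀ β : Ioi (0 : ℝ), IsGammaProcessLaw T α β (P β)) :
    Measurable fun z : (Ioi (0 : ℝ) × Ioi (0 : ℝ)) × SubPath T =>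
      gammaProposal P z.1.1 z.1.2 z.2 := by
  classical
  have := isProbabilityMeasure_gammaProposal fun b => (hP b).isProbabilityMeasure
  refine measurable_of_moments SubPath.measurableSpace_eq_iSup_comap_expCoord fun s n => ?_
  obtain ⟨N, τ, h⟩ := IsPartition.exists_seq hT s
  have hβ : Measurable fun z : (Ioi (0 : ℝ) × Ioi (0 : ℝ)) × SubPath T => (z.1.1 : ℝ) := by
    fun_prop
  have hβ' : Measurable fun z : (Ioi (0 : ℝ) × Ioi (0 : ℝ)) × SubPath T => (z.1.2 : ℝ) := by
    fun_prop
  have hx := (SubPath.measurable_prod_exp s n).comp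
    (measurable_snd : Measurable fun z : (Ioi (0 : ℝ) × Ioi (0 : ℝ)) × SubPath T => z.2)
  -- Only the thinning branch depends on `k`. The path is arbitrary here, so the discretization runs
  -- over its jump part, which is measurable and is all that the thinning sees. The additive branch
  -- is exact for any partition, so partition `0` serves.
  refine measurable_of_tendsto_metrizable
    (f := fun k (z : (Ioi (0 : ℝ) × Ioi (0 : ℝ)) × SubPath T) =>
      if (z.1.1 : ℝ) < z.1.2 then (∏ t ∈ s, Real.exp (-z.2 t) ^ n t)
        * ∏ i ∈ Finset.range (N 0), (α / (α + tailWeight s n (τ 0 (i + 1))))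
          ^ (((z.1.2 : ℝ) - z.1.1) * ((τ 0 (i + 1) : ℝ) - τ 0 i))
      else if (z.1.2 : ℝ) < z.1.1 then
        SubPath.discreteThin ((z.1.2 : ℝ) / z.1.1) s n (N k) (τ k) z.2.jumpPart
      else ∏ t ∈ s, Real.exp (-z.2 t) ^ n t) (fun k => ?_) (tendsto_pi_nhds.2 ?_)
  · refine Measurable.ite (measurableSet_lt hβ hβ') (hx.mul (by fun_prop))
      (Measurable.ite (measurableSet_lt hβ' hβ) ?_ hx)
    have hJ : ∀ t, Measurable fun z : (Ioi (0 : ℝ) × Ioi (0 : ℝ)) × SubPath T => z.2.jumpPart t :=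
      fun t => (SubPath.measurable_apply t).comp (SubPath.measurable_jumpPart.comp measurable_snd)
    exact Finset.measurable_prod _ fun i _ => continuous_thinFactor.measurable.comp
      ((hβ'.div hβ).prodMk (measurable_const.prodMk ((hJ _).sub (hJ _))))
  · rintro ⟨⟨β, β'⟩, x⟩
    change Tendsto _ atTop (𝓝 (∫ y, ∏ t ∈ s, Real.exp (-y t) ^ n t ∂gammaProposal P β β' x))
    rcases lt_trichotomy β β' with hlt | rfl | hlt
    · have hlt' : (β : ℝ) < β' := hlt
      rw [integral_gammaProposal_of_lt hlt]
      simp only [hlt', if_true]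
      rw [(hP (shapeSub β' β hlt)).integral_prod_exp hα (shapeSub β' β hlt).2 (h 0) n]
      exact tendsto_const_nhds
    · rw [integral_gammaProposal_self]
      simp
    · have hlt' : (β' : ℝ) < β := hlt
      rw [integral_gammaProposal_of_gt hlt]
      simp only [hlt', hlt'.not_gt, if_true, if_false]
      exact x.tendsto_discreteThin (thinProb β β' hlt.le) h n

lemma lintegral_gammaProposal_of_gt (hT : 0 ≤ T) (hα : 0 < α)
    (hP : ∀ β : Ioi (0 : ℝ), IsGammaProcessLaw T α β (P β)) {β β' : Ioi (0 : ℝ)} (hlt : β' < β)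
    {S : Set (SubPath T × SubPath T)} (hS : MeasurableSet S) :
    ∫⁻ x, ∫⁻ x', S.indicator 1 (x, x') ∂(gammaProposal P β β' x) ∂(P β)
      = ∫⁻ x', ∫⁻ x, S.indicator 1 (x, x') ∂(gammaProposal P β' β x') ∂(P β') := by
  have hprob := fun b => (hP b).isProbabilityMeasure
  have hprob' := isProbabilityMeasure_gammaProposal hprob
  have hm := measurable_gammaProposal hT hα hP
  let κ : Ioi (0 : ℝ) → Ioi (0 : ℝ) → Kernel (SubPath T) (SubPath T) := fun b b' =>
    ⟨gammaProposal P b b', hm.comp (measurable_prodMk_left (x := (b, b')))⟩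
  have hκ : ∀ b b', IsMarkovKernel (κ b b') := fun b b' => ⟨hprob' b b'⟩
  have : IsProbabilityMeasure ((P β' ⊗ₘ κ β' β).map Prod.swap) :=
    Measure.isProbabilityMeasure_map measurable_swap.aemeasurable
  -- Equality of joint Laplace transforms: on the right the swapped pair is `(y + z, y)` with `z`
  -- drawn from `P (β - β')`.
  have key : P β ⊗ₘ κ β β' = (P β' ⊗ₘ κ β' β).map Prod.swap := by
    refine SubPath.ext_of_integral_prod_exp fun s s' n n' => ?_
    have h1 := SubPath.integrable_prod_exp_mul_prod_exp (P β ⊗ₘ κ β β') s s' n n'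
    have h2 := SubPath.integrable_prod_exp_mul_prod_exp
      ((P β' ⊗ₘ κ β' β).map Prod.swap) s s' n n'
    have h3 := (integrable_map_measure h2.1 measurable_swap.aemeasurable).1 h2
    rw [Measure.integral_compProd h1, integral_map measurable_swap.aemeasurable h2.1]
    refine Eq.trans ?_ (Measure.integral_compProd h3).symm
    simp only [Function.comp, Prod.fst_swap, Prod.snd_swap, integral_const_mul,
      integral_mul_const]
    change ∫ x, _ * ∫ y, _ ∂gammaProposal P β β' x ∂P β
      = ∫ y, (∫ x, _ ∂gammaProposal P β' β y) * _ ∂P β'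
    simp_rw [integral_gammaProposal_of_gt hlt, integral_gammaProposal_of_lt hlt]
    rw [IsGammaProcessLaw.integral_prod_exp_mul_integral_thin hT hα β.2 β'.2 hlt (hP β) (hP β')
      (hP (shapeSub β β' hlt)) (thinProb β β' hlt.le) rfl, ← integral_mul_const]
    congr 1
    ext y
    ring
  have hind : Measurable (S.indicator (1 : SubPath T × SubPath T → ENNReal)) :=
    measurable_one.indicator hS
  have h1 := Measure.lintegral_compProd (μ := P β) (κ := κ β β') hind
  have h2 := Measure.lintegral_compProd (μ := P β') (κ := κ β' β) (hind.comp measurable_swap)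
  rw [key, lintegral_map hind measurable_swap] at h1
  exact h1.symm.trans h2

theorem lintegral_gammaProposal_comm (hT : 0 ≤ T) (hα : 0 < α)
    (hP : ∀ β : Ioi (0 : ℝ), IsGammaProcessLaw T α β (P β)) (β β' : Ioi (0 : ℝ))
    {S : Set (SubPath T × SubPath T)} (hS : MeasurableSet S) :
    ∫⁻ x, ∫⁻ x', S.indicator 1 (x, x') ∂(gammaProposal P β β' x) ∂(P β)
      = ∫⁻ x', ∫⁻ x, S.indicator 1 (x, x') ∂(gammaProposal P β' β x') ∂(P β') := by
  rcases lt_trichotomy β β' with h | rfl | h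
  · exact (lintegral_gammaProposal_of_gt hT hα hP h (measurable_swap hS)).symm
  · have hind : Measurable (S.indicator (1 : SubPath T × SubPath T → ENNReal)) :=
      measurable_one.indicator hS
    refine lintegral_congr fun x => ?_
    rw [gammaProposal_self]
    exact (lintegral_dirac' x (hind.comp measurable_prodMk_left)).trans
      (lintegral_dirac' x (hind.comp measurable_prodMk_right)).symm
  · exact lintegral_gammaProposal_of_gt hT hα hP h hS

/-- Needed for the product measure on pairs of parameters and for exchanging the two integrals. -/
instance : SFinite shapeVolume := by
  have : IsFiniteMeasureOnCompacts shapeVolume :=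
    .comap' _ continuous_subtype_val (MeasurableEmbedding.subtype_coe measurableSet_Ioi)
  have := (isOpen_Ioi (a := (0 : ℝ))).locallyCompactSpace
  infer_instance

end Kernels

/-! ### The symmetric measure -/

theorem mainTheorem5 (T α : ℝ) (hT : 0 < T) (hα : 0 < α)
    (P : Ioi (0 : ℝ) → Measure (SubPath T))
    (hP : ∀ β : Ioi (0 : ℝ), IsGammaProcessLaw T α β (P β)) :
    -- the laws and the proposals are probability kernels, jointly in the parameters and the path
    Measurable P ∧
    Measurable (fun z : (Ioi (0 : ℝ) × Ioi (0 : ℝ)) × SubPath T =>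
      gammaProposal P z.1.1 z.1.2 z.2) ∧
    (∀ (β β' : Ioi (0 : ℝ)) (x : SubPath T), IsProbabilityMeasure (gammaProposal P β β' x)) ∧
    -- transdimensional balance, as an equality of measures on pairs of paths
    (∀ (β β' : Ioi (0 : ℝ)) (S : Set (SubPath T × SubPath T)), MeasurableSet S →
      ∫⁻ x, ∫⁻ x', S.indicator 1 (x, x') ∂(gammaProposal P β β' x) ∂(P β)
        = ∫⁻ x', ∫⁻ x, S.indicator 1 (x, x') ∂(gammaProposal P β' β x') ∂(P β')) ∧
    -- the measure `dβ dβ' P_β(dx) Q_{β, β'}(x; dx')` is well defined and symmetric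
    (∃ μ : Measure ((Ioi (0 : ℝ) × SubPath T) × (Ioi (0 : ℝ) × SubPath T)),
      (∀ S, MeasurableSet S →
        μ S = ∫⁻ β, ∫⁻ β', ∫⁻ x, ∫⁻ x',
          S.indicator 1 ((β, x), (β', x')) ∂(gammaProposal P β β' x) ∂(P β)
            ∂shapeVolume ∂shapeVolume) ∧
      μ.map Prod.swap = μ) := by
  have hPm := measurable_gammaLaw hT.le hα hP
  have hQm := measurable_gammaProposal hT.le hα hP
  have hprob := fun b => (hP b).isProbabilityMeasure
  have hQ := isProbabilityMeasure_gammaProposal hprob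
  refine ⟨hPm, hQm, hQ, fun β β' S hS => lintegral_gammaProposal_comm hT.le hα hP β β' hS, ?_⟩
  let κ₁ : Kernel (Ioi (0 : ℝ) × Ioi (0 : ℝ)) (SubPath T) :=
    ⟨fun b => P b.1, hPm.comp measurable_fst⟩
  let κ₂ : Kernel ((Ioi (0 : ℝ) × Ioi (0 : ℝ)) × SubPath T) (SubPath T) := ⟨_, hQm⟩
  have : IsMarkovKernel κ₁ := ⟨fun b => hprob b.1⟩
  have : IsMarkovKernel κ₂ := ⟨fun z => hQ z.1.1 z.1.2 z.2⟩
  -- The composition product puts both parameters before both paths; `g` regroups them into two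
  -- (parameter, path) pairs.
  let g : (Ioi (0 : ℝ) × Ioi (0 : ℝ)) × SubPath T × SubPath T →
      (Ioi (0 : ℝ) × SubPath T) × (Ioi (0 : ℝ) × SubPath T) :=
    fun q => ((q.1.1, q.2.1), (q.1.2, q.2.2))
  have hg : Measurable g := by fun_prop
  have hfib : ∀ S : Set ((Ioi (0 : ℝ) × SubPath T) × (Ioi (0 : ℝ) × SubPath T)),
      MeasurableSet S → ∀ b, ∫⁻ z, S.indicator 1 (g (b, z)) ∂(κ₁ ⊗ₖ κ₂) b
        = ∫⁻ x, ∫⁻ x', S.indicator 1 ((b.1, x), (b.2, x')) ∂(gammaProposal P b.1 b.2 x)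
          ∂(P b.1) := fun S hS b =>
    Kernel.lintegral_compProd _ _ _
      ((measurable_one.indicator hS).comp (hg.comp measurable_prodMk_left))
  have hmeas : ∀ S : Set ((Ioi (0 : ℝ) × SubPath T) × (Ioi (0 : ℝ) × SubPath T)),
      MeasurableSet S → Measurable fun b : Ioi (0 : ℝ) × Ioi (0 : ℝ) =>
        ∫⁻ x, ∫⁻ x', S.indicator 1 ((b.1, x), (b.2, x')) ∂(gammaProposal P b.1 b.2 x)
          ∂(P b.1) := fun S hS => by
    simp_rw [← hfib S hS]
    exact Measurable.lintegral_kernel_prod_right' ((measurable_one.indicator hS).comp hg)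
  have hμ : ∀ S, MeasurableSet S →
      ((shapeVolume.prod shapeVolume) ⊗ₘ (κ₁ ⊗ₖ κ₂)).map g S = ∫⁻ β, ∫⁻ β', ∫⁻ x, ∫⁻ x',
        S.indicator 1 ((β, x), (β', x')) ∂(gammaProposal P β β' x) ∂(P β)
          ∂shapeVolume ∂shapeVolume := fun S hS => by
    rw [← lintegral_indicator_one hS, lintegral_map (measurable_one.indicator hS) hg]
    refine (Measure.lintegral_compProd ((measurable_one.indicator hS).comp hg)).trans ?_
    simp only [Function.comp, hfib S hS]
    rw [lintegral_prod _ (hmeas S hS).aemeasurable]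
  refine ⟨_, hμ, Measure.ext fun S hS => ?_⟩
  -- Tonelli exchanges the parameters; what remains is balance at fixed `β, β'` for the section of
  -- `S`.
  rw [Measure.map_apply measurable_swap hS, hμ _ (measurable_swap hS), hμ S hS,
    lintegral_lintegral_swap (hmeas _ (measurable_swap hS)).aemeasurable]
  refine lintegral_congr fun β => lintegral_congr fun β' => ?_
  have hsec : Measurable fun z : SubPath T × SubPath T => ((β, z.1), (β', z.2)) := by fun_prop
  exact (lintegral_gammaProposal_comm hT.le hα hP β β' (hsec hS)).symm
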